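/- Let $\mathbb H$ be the quaternions, $\mathbb B=\{q\in\mathbb H:|q|<1\}$ and $\mathbb S=\{q\in\mathbb H: q^2=-1\}$. A function $f:\mathbb B\to\mathbb H$ is (slice) regular if for every $I\in\mathbb S$ its restriction to $\mathbb B\cap(\mathbb R+\mathbb RI)$ has continuous partial derivatives and satisfies $\frac12(\partial_x+I\partial_y)f(x+yI)=0$. For $0<p\le\infty$, $H^p(\mathbb B)$ is the set of regular $f$ with $\|f\|_p<\infty$, where $$\|f\|_p=\sup_{I\in\mathbb S}\lim_{r\to1^-}\Big(\frac1{2\pi}\int_0^{2\pi}|f(re^{I\theta})|^p\,d\theta\Big)^{1/p}\quad(p<\infty),\qquad \|f\|_\infty=\sup_{q\in\mathbb B}|f(q)|.$$ Write $*$ for the regular product, i.e. $(\sum q^na_n)*(\sum q^nb_n)=\sum q^n\sum_{k=0}^{n}a_kb_{n-k}$. Let $f\not\equiv0$ be regular on $\mathbb B$. For a sphere $x+y\mathbb S\subset\mathbb B$, $y\neq0$, write $$f(q)=\big((q-x)^2+y^2\big)^m\,\big[(q-p_1)*\cdots*(q-p_n)*g(q)\big]$$ with $m,n\ge0$, $p_i\in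 x+y\mathbb S$, $p_i\ne\overline{p_{i+1}}$ for $1\le i<n$, and $g$ regular on $\mathbb B$ without zeros on $x+y\mathbb S$; then $2m$ is the spherical multiplicity of $x+y\mathbb S$ and, if $n\ge1$, $n$ is the isolated multiplicity of $p_1$. The isolated multiplicity of $f$ at a real point $x\in\mathbb B$ is the $k\ge0$ with $f(q)=(q-x)^kh(q)$, $h$ regular on $\mathbb B$, $h(x)\neq0$. The sequence of zeros of $f$ (finite or infinite) lists the zeros in $\mathbb B$ as follows: each point is listed as many times as its isolated multiplicity, and each sphere of spherical multiplicity $2m>0$ is represented, in addition, by one of its points $a$ and the conjugate $\bar a$, each listed $m$ times. **Proposition.** Let $p\in(0,\infty]$, let $f\in H^p(\mathbb B)$, $f\not\equiv0$, and let $\{b_n\}$ be its sequence of zeros. Then $\{b_n\}$ satisfies the Blaschke condition $$\sum_{n}(1-|b_n|)<+\infty .$$ -/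

import Mathlib

open scoped Quaternion ENNReal Topology
open Filter MeasureTheory

namespace QuaternionHardy

/-- The open unit ball `𝔹` of the quaternions. -/
def unitBall : Set ℍ[ℝ] := Metric.ball 0 1

/-- The sphere `𝕊` of imaginary units, `q ^ 2 = -1`. -/
def imagUnits : Set ℍ[ℝ] := {q | q ^ 2 = -1}

/-- The parametrization `x + i y ↦ x + y I` of the slice `L_I` by the complex plane. -/
noncomputable def sliceMap (I : ℍ[ℝ]) (z : ℂ) : ℍ[ℝ] := (z.re : ℍ[ℝ]) + (z.im : ℍ[ℝ]) * I

/-- The operator `∂̄_I = (∂/∂x + I ∂/∂y) / 2` applied to `f`, at the point `x + y I`, `z = x + i y`. -/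
noncomputable def dbar (f : ℍ[ℝ] → ℍ[ℝ]) (I : ℍ[ℝ]) (z : ℂ) : ℍ[ℝ] :=
  (1 / 2 : ℝ) • (fderiv ℝ (fun w : ℂ => f (sliceMap I w)) z 1
    + I * fderiv ℝ (fun w : ℂ => f (sliceMap I w)) z Complex.I)

/-- `f` is slice regular on `𝔹`: each restriction to `𝔹 ∩ L_I` is `C¹` and killed by `∂̄_I`.
Only the values of `f` on `𝔹` matter. -/
def SliceRegular (f : ℍ[ℝ] → ℍ[ℝ]) : Prop :=
  ∀ I ∈ imagUnits,
    ContDiffOn ℝ 1 (fun z : ℂ => f (sliceMap I z)) (Metric.ball 0 1) ∧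
    ∀ z ∈ Metric.ball (0 : ℂ) 1, dbar f I z = 0

/-- The integral mean `M_p(f_I, r)` over the circle of radius `r` in `L_I`, for `0 < p < ∞`. -/
noncomputable def integralMean (f : ℍ[ℝ] → ℍ[ℝ]) (p : ℝ) (I : ℍ[ℝ]) (r : ℝ) : ℝ≥0∞ :=
  (ENNReal.ofReal (1 / (2 * Real.pi)) *
    ∫⁻ θ in Set.Ioc 0 (2 * Real.pi), ‖f (sliceMap I (circleMap 0 r θ))‖ₑ ^ p) ^ (1 / p)

/-- The Hardy norm `‖f‖_p`, with values in `[0, ∞]`. For regular `f` the mean is increasing in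
`r ∈ [0, 1)`, so that the upper limit below is the limit. -/
noncomputable def hardyNorm (f : ℍ[ℝ] → ℍ[ℝ]) (p : ℝ≥0∞) : ℝ≥0∞ :=
  if p = ∞ then ⨆ q ∈ unitBall, ‖f q‖ₑ
  else ⨆ I ∈ imagUnits, limsup (fun r : ℝ => integralMean f p.toReal I r) (𝓝[<] 1)

/-- Membership in the quaternionic Hardy space `H^p(𝔹)`. -/
def MemHardy (f : ℍ[ℝ] → ℍ[ℝ]) (p : ℝ≥0∞) : Prop :=
  SliceRegular f ∧ hardyNorm f p < ∞

/-- The imaginary unit `I` of a non-real quaternion `q = x + y I`, `y > 0`; it is `0` for real `q`. -/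
noncomputable def unitIm (q : ℍ[ℝ]) : ℍ[ℝ] := ‖q.im‖⁻¹ • q.im

/-- The component `α` of `f (x + y I) = α (x, y) + I β (x, y)`. -/
noncomputable def stemRe (f : ℍ[ℝ] → ℍ[ℝ]) (q : ℍ[ℝ]) : ℍ[ℝ] :=
  (1 / 2 : ℝ) • (f q + f (star q))

/-- The component `β` of `f (x + y I) = α (x, y) + I β (x, y)`. -/
noncomputable def stemIm (f : ℍ[ℝ] → ℍ[ℝ]) (q : ℍ[ℝ]) : ℍ[ℝ] :=
  -(unitIm q * ((1 / 2 : ℝ) • (f q - f (star q))))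

/-- The regular product `f * g`. If `f (x + y I) = α + I β` and `g (x + y I) = γ + I δ` for all
imaginary units `I`, then `(f * g) (x + y I) = (α γ - β δ) + I (α δ + β γ)`. On power series it is
the product `(∑ qⁿ aₙ) * (∑ qⁿ bₙ) = ∑ qⁿ (∑ₖ aₖ bₙ₋ₖ)`. -/
noncomputable def starMul (f g : ℍ[ℝ] → ℍ[ℝ]) (q : ℍ[ℝ]) : ℍ[ℝ] :=
  (stemRe f q * stemRe g q - stemIm f q * stemIm g q)
    + unitIm q * (stemRe f q * stemIm g q + stemIm f q * stemRe g q)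

/-- The regular product `(q - p₁) * ⋯ * (q - pₙ) * g`. -/
noncomputable def linearStarProd (ps : List ℍ[ℝ]) (g : ℍ[ℝ] → ℍ[ℝ]) : ℍ[ℝ] → ℍ[ℝ] :=
  ps.foldr (fun p h => starMul (fun q => q - p) h) g

/-- The `2`-sphere `x + y 𝕊`. -/
def sphereAt (x y : ℝ) : Set ℍ[ℝ] := {q | ∃ I ∈ imagUnits, q = (x : ℍ[ℝ]) + (y : ℍ[ℝ]) * I}

/-- On the sphere `x + y 𝕊` the function `f` has spherical multiplicity `2 m`, and isolated
multiplicity `ps.length` at the first entry of `ps` (if there is one). -/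
def HasSphereMultiplicities (f : ℍ[ℝ] → ℍ[ℝ]) (x y : ℝ) (m : ℕ) (ps : List ℍ[ℝ]) : Prop :=
  (∀ p ∈ ps, p ∈ sphereAt x y) ∧ ps.IsChain (fun p p' => p ≠ star p') ∧
  ∃ g : ℍ[ℝ] → ℍ[ℝ], SliceRegular g ∧ (∀ q ∈ sphereAt x y, g q ≠ 0) ∧
    ∀ q ∈ unitBall,
      f q = ((q - (x : ℍ[ℝ])) ^ 2 + (y : ℍ[ℝ]) ^ 2) ^ m * linearStarProd ps g q

/-- `f` has isolated multiplicity `k` at the real point `x`. -/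
def HasRealMultiplicity (f : ℍ[ℝ] → ℍ[ℝ]) (x : ℝ) (k : ℕ) : Prop :=
  ∃ h : ℍ[ℝ] → ℍ[ℝ], SliceRegular h ∧ h (x : ℍ[ℝ]) ≠ 0 ∧
    ∀ q ∈ unitBall, f q = (q - (x : ℍ[ℝ])) ^ k * h q

/-- The family `b` (a finite or infinite sequence, say) lists the zeros of `f` in `𝔹`: a real zero
and a non-real zero with isolated multiplicity `k` is listed `k` times, and a sphere of zeros of
spherical multiplicity `2 m` is represented by `m` copies of one of its points `a` together with
`m` copies of the conjugate of `a`. If a sphere of zeros also carries a point of positive isolated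
multiplicity, that point is listed in addition. -/
structure IsZeroSequence {ι : Type*} (f : ℍ[ℝ] → ℍ[ℝ]) (b : ι → ℍ[ℝ]) : Prop where
  zero : ∀ i, b i ∈ unitBall ∧ f (b i) = 0
  real : ∀ (x : ℝ) (k : ℕ), (x : ℍ[ℝ]) ∈ unitBall → HasRealMultiplicity f x k →
    {i | b i = (x : ℍ[ℝ])}.encard = k
  sphere : ∀ (x y : ℝ) (m : ℕ) (ps : List ℍ[ℝ]), 0 < y → sphereAt x y ⊆ unitBall →
    HasSphereMultiplicities f x y m ps →
    ∃ a ∈ sphereAt x y, ∀ q ∈ sphereAt x y,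
      {i | b i = q}.encard =
        Set.indicator {a, star a} (fun _ => (m : ℕ∞)) q
          + Set.indicator {p | ps.head? = some p} (fun _ => (ps.length : ℕ∞)) q

end QuaternionHardy

/-! A regular `f` is encoded by a holomorphic stem function `h = a + i b` from the disc to `ℍ ⊗ ℂ`,
symmetric under complex conjugation, with `f (x + y I) = a + I b` for every imaginary unit `I`. The
regular product becomes the pointwise product of stem functions. The norm form `N(h) = |a|² - |b|² +
2 i ⟨a, b⟩` is a scalar holomorphic function, multiplicative in `h`, and the claim reduces to the
classical Blaschke condition for `N(h)`.

Zeros: `N(h)` vanishes at `x + i y` exactly when `f` vanishes somewhere on `x + y 𝕊`. A spherical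
factor adds 2 to the order of `N(h)` there, a linear factor adds 1, and a factor `q - x` at a real
point adds 2. The order is thus `2m + n` or `2k`, at least the number of terms listed on the sphere
(`card_filter_le_stemOrder`). A zero sequence is constrained only through a given factorization of
`f`, so factorizations have to be constructed (`exists_hasSphereMultiplicities`,
`exists_hasRealMultiplicity`).

Growth: by the parallelogram law `|N(h)| ≤ |a|² + |b|²` is at most the squared maximum of `|f|` at
`x ± y I`. The Hardy norm therefore bounds the circle means of `log |N(h)|`
(`MemHardy.exists_circleAverage_log_le`), and Jensen's formula turns this into a bound on the sum of
`ord · (1 - |z|)` (`exists_sum_order_mul_le`). -/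

namespace QuaternionHardy

open scoped ComplexConjugate

/-! ### Quaternions with complex coefficients, imaginary units and slices -/

/-- The complexification `q ⊗ 1` of a real quaternion. -/
noncomputable def complexify (q : ℍ[ℝ]) : ℍ[ℂ] := ⟨q.re, q.imI, q.imJ, q.imK⟩

/-- Complex conjugation of the coefficients of a complexified quaternion. -/
noncomputable def conjCoeff (w : ℍ[ℂ]) : ℍ[ℂ] := ⟨conj w.re, conj w.imI, conj w.imJ, conj w.imK⟩

/-- The component `a` of `a + i b ∈ ℍ ⊗ ℂ`. -/
noncomputable def rePart (w : ℍ[ℂ]) : ℍ[ℝ] := ⟨w.re.re, w.imI.re, w.imJ.re, w.imK.re⟩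

/-- The component `b` of `a + i b ∈ ℍ ⊗ ℂ`. -/
noncomputable def imPart (w : ℍ[ℂ]) : ℍ[ℝ] := ⟨w.re.im, w.imI.im, w.imJ.im, w.imK.im⟩

/-- The map `a + i b ↦ a + I b` from `ℍ ⊗ ℂ` to `ℍ`. -/
noncomputable def evalAt (I : ℍ[ℝ]) (w : ℍ[ℂ]) : ℍ[ℝ] := rePart w + I * imPart w

@[simp] theorem complexify_re (q : ℍ[ℝ]) : (complexify q).re = (q.re : ℂ) := rfl
@[simp] theorem complexify_imI (q : ℍ[ℝ]) : (complexify q).imI = (q.imI : ℂ) := rfl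
@[simp] theorem complexify_imJ (q : ℍ[ℝ]) : (complexify q).imJ = (q.imJ : ℂ) := rfl
@[simp] theorem complexify_imK (q : ℍ[ℝ]) : (complexify q).imK = (q.imK : ℂ) := rfl
@[simp] theorem conjCoeff_re (w : ℍ[ℂ]) : (conjCoeff w).re = conj w.re := rfl
@[simp] theorem conjCoeff_imI (w : ℍ[ℂ]) : (conjCoeff w).imI = conj w.imI := rfl
@[simp] theorem conjCoeff_imJ (w : ℍ[ℂ]) : (conjCoeff w).imJ = conj w.imJ := rfl
@[simp] theorem conjCoeff_imK (w : ℍ[ℂ]) : (conjCoeff w).imK = conj w.imK := rfl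
@[simp] theorem rePart_re (w : ℍ[ℂ]) : (rePart w).re = w.re.re := rfl
@[simp] theorem rePart_imI (w : ℍ[ℂ]) : (rePart w).imI = w.imI.re := rfl
@[simp] theorem rePart_imJ (w : ℍ[ℂ]) : (rePart w).imJ = w.imJ.re := rfl
@[simp] theorem rePart_imK (w : ℍ[ℂ]) : (rePart w).imK = w.imK.re := rfl
@[simp] theorem imPart_re (w : ℍ[ℂ]) : (imPart w).re = w.re.im := rfl
@[simp] theorem imPart_imI (w : ℍ[ℂ]) : (imPart w).imI = w.imI.im := rfl
@[simp] theorem imPart_imJ (w : ℍ[ℂ]) : (imPart w).imJ = w.imJ.im := rfl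
@[simp] theorem imPart_imK (w : ℍ[ℂ]) : (imPart w).imK = w.imK.im := rfl

/-- The quaternion unit `i`. -/
noncomputable def unitI : ℍ[ℝ] := ⟨0, 1, 0, 0⟩
@[simp] theorem unitI_re : unitI.re = 0 := rfl
@[simp] theorem unitI_imI : unitI.imI = 1 := rfl
@[simp] theorem unitI_imJ : unitI.imJ = 0 := rfl
@[simp] theorem unitI_imK : unitI.imK = 0 := rfl

theorem mem_imagUnits_iff {I : ℍ[ℝ]} :
    I ∈ imagUnits ↔ I.re = 0 ∧ I.imI ^ 2 + I.imJ ^ 2 + I.imK ^ 2 = 1 := by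
  simp only [imagUnits, Set.mem_ofPred_eq, sq I, Quaternion.ext_iff]
  simp
  constructor
  · rintro ⟨h1, h2, h3, h4⟩
    have hr : I.re = 0 := by
      by_contra hne
      have h2' : I.imI = 0 := by
        have : I.re * I.imI = 0 := by linarith
        simpa [hne] using this
      have h3' : I.imJ = 0 := by
        have : I.re * I.imJ = 0 := by linarith
        simpa [hne] using this
      have h4' : I.imK = 0 := by
        have : I.re * I.imK = 0 := by linarith
        simpa [hne] using this
      rw [h2', h3', h4'] at h1
      nlinarith [sq_nonneg I.re]
    refine ⟨hr, ?_⟩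
    rw [hr] at h1
    linarith
  · rintro ⟨h1, h2⟩
    rw [h1]
    refine ⟨by linarith, by ring, by ring, by ring⟩

theorem neg_mem_imagUnits {I : ℍ[ℝ]} (hI : I ∈ imagUnits) : -I ∈ imagUnits := by
  simpa [imagUnits] using hI

theorem mul_self_of_mem_imagUnits {I : ℍ[ℝ]} (hI : I ∈ imagUnits) : I * I = -1 := by
  rw [← sq]; exact hI

theorem unitI_mem_imagUnits : unitI ∈ imagUnits :=
  mem_imagUnits_iff.2 (by simp)

theorem sliceMap_re (I : ℍ[ℝ]) (z : ℂ) : (sliceMap I z).re = z.re + z.im * I.re := by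
  simp [sliceMap]
theorem sliceMap_imI (I : ℍ[ℝ]) (z : ℂ) : (sliceMap I z).imI = z.im * I.imI := by
  simp [sliceMap]
theorem sliceMap_imJ (I : ℍ[ℝ]) (z : ℂ) : (sliceMap I z).imJ = z.im * I.imJ := by
  simp [sliceMap]
theorem sliceMap_imK (I : ℍ[ℝ]) (z : ℂ) : (sliceMap I z).imK = z.im * I.imK := by
  simp [sliceMap]

theorem norm_sq_eq (q : ℍ[ℝ]) : ‖q‖ ^ 2 = q.re ^ 2 + q.imI ^ 2 + q.imJ ^ 2 + q.imK ^ 2 := by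
  rw [sq, ← Quaternion.normSq_eq_norm_mul_self, Quaternion.normSq_def']

theorem norm_sliceMap {I : ℍ[ℝ]} (hI : I ∈ imagUnits) (z : ℂ) : ‖sliceMap I z‖ = ‖z‖ := by
  obtain ⟨h0, h1⟩ := mem_imagUnits_iff.1 hI
  rw [← sq_eq_sq₀ (norm_nonneg _) (norm_nonneg _), norm_sq_eq, sliceMap_re, sliceMap_imI,
    sliceMap_imJ, sliceMap_imK, h0, Complex.sq_norm, Complex.normSq_apply]
  linear_combination z.im ^ 2 * h1

theorem sliceMap_mem_unitBall {I : ℍ[ℝ]} (hI : I ∈ imagUnits) {z : ℂ} :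
    sliceMap I z ∈ unitBall ↔ z ∈ Metric.ball (0 : ℂ) 1 := by
  simp [unitBall, norm_sliceMap hI]

theorem sliceMap_ofReal (I : ℍ[ℝ]) (x : ℝ) : sliceMap I x = (x : ℍ[ℝ]) := by
  simp [sliceMap]

/-- Each point of a slice has two presentations, by `I` and by `-I`. The symmetry of stem functions
makes them give the same value. -/
theorem sliceMap_neg_conj (I : ℍ[ℝ]) (z : ℂ) : sliceMap (-I) (conj z) = sliceMap I z := by
  simp [sliceMap]

theorem sliceMap_conj {I : ℍ[ℝ]} (hI : I ∈ imagUnits) (z : ℂ) :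
    sliceMap I (conj z) = star (sliceMap I z) := by
  have := (mem_imagUnits_iff.1 hI).1
  ext <;> simp [sliceMap, this, mul_comm]

/-- Every quaternion lies on a slice, in its closed upper half plane. -/
theorem exists_sliceMap_eq (q : ℍ[ℝ]) :
    ∃ I ∈ imagUnits, q = sliceMap I ⟨q.re, ‖q.im‖⟩ := by
  by_cases h : q.im = 0
  · refine ⟨_, unitI_mem_imagUnits, ?_⟩
    have h1 : q.imI = 0 := congrArg QuaternionAlgebra.imI h
    have h2 : q.imJ = 0 := congrArg QuaternionAlgebra.imJ h
    have h3 : q.imK = 0 := congrArg QuaternionAlgebra.imK h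
    ext <;> simp [sliceMap, h, h1, h2, h3]
  · have hn : ‖q.im‖ ≠ 0 := norm_ne_zero_iff.2 h
    have h2 := norm_sq_eq q.im
    simp at h2
    refine ⟨unitIm q, mem_imagUnits_iff.2 ?_, ?_⟩
    · simp only [unitIm]
      simp
      field_simp
      linarith
    · ext <;> simp [sliceMap, unitIm] <;> field_simp

theorem norm_of_mem_imagUnits {I : ℍ[ℝ]} (hI : I ∈ imagUnits) : ‖I‖ = 1 := by
  simpa [sliceMap] using norm_sliceMap hI Complex.I

theorem im_sliceMap {I : ℍ[ℝ]} (hI : I ∈ imagUnits) (z : ℂ) : (sliceMap I z).im = z.im • I := by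
  have := (mem_imagUnits_iff.1 hI).1
  ext <;> simp [sliceMap, this]

theorem norm_im_sliceMap {I : ℍ[ℝ]} (hI : I ∈ imagUnits) (z : ℂ) : ‖(sliceMap I z).im‖ = |z.im| := by
  rw [im_sliceMap hI, norm_smul, norm_of_mem_imagUnits hI, mul_one, Real.norm_eq_abs]

theorem unitIm_sliceMap {I : ℍ[ℝ]} (hI : I ∈ imagUnits) {z : ℂ} (hz : 0 < z.im) :
    unitIm (sliceMap I z) = I := by
  rw [unitIm, norm_im_sliceMap hI, im_sliceMap hI, abs_of_pos hz, smul_smul,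
    inv_mul_cancel₀ hz.ne', one_smul]

theorem re_sliceMap {I : ℍ[ℝ]} (hI : I ∈ imagUnits) (z : ℂ) : (sliceMap I z).re = z.re := by
  rw [sliceMap_re, (mem_imagUnits_iff.1 hI).1, mul_zero, add_zero]

theorem mem_sphereAt_iff {x y : ℝ} {q : ℍ[ℝ]} :
    q ∈ sphereAt x y ↔ ∃ I ∈ imagUnits, q = sliceMap I ⟨x, y⟩ := Iff.rfl

/-! ### Evaluation at an imaginary unit and the norm form -/

theorem evalAt_smul {I : ℍ[ℝ]} (hI : I ∈ imagUnits) (c : ℂ) (w : ℍ[ℂ]) :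
    evalAt I (c • w) = sliceMap I c * evalAt I w := by
  have h1 : rePart (c • w) = c.re • rePart w - c.im • imPart w := by
    ext <;> simp
  have h2 : imPart (c • w) = c.re • imPart w + c.im • rePart w := by
    ext <;> simp
  rw [evalAt, evalAt, h1, h2, sliceMap]
  simp only [Quaternion.coe_mul_eq_smul, add_mul, mul_add, smul_mul_assoc, mul_smul_comm]
  rw [← mul_assoc I I, mul_self_of_mem_imagUnits hI]
  simp only [neg_mul, one_mul, smul_neg]
  abel

/-- With `imPart_mul`, this matches the product of `ℍ ⊗ ℂ` with the formula defining `starMul`. -/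
theorem rePart_mul (v w : ℍ[ℂ]) :
    rePart (v * w) = rePart v * rePart w - imPart v * imPart w := by
  ext <;> simp <;> ring

theorem imPart_mul (v w : ℍ[ℂ]) :
    imPart (v * w) = rePart v * imPart w + imPart v * rePart w := by
  ext <;> simp <;> ring

theorem conjCoeff_mul (v w : ℍ[ℂ]) : conjCoeff (v * w) = conjCoeff v * conjCoeff w := by
  ext <;> simp

theorem conjCoeff_smul (c : ℂ) (w : ℍ[ℂ]) : conjCoeff (c • w) = conj c • conjCoeff w := by
  ext <;> simp

theorem evalAt_neg_conjCoeff (I : ℍ[ℝ]) (w : ℍ[ℂ]) : evalAt (-I) (conjCoeff w) = evalAt I w := by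
  have h1 : rePart (conjCoeff w) = rePart w := by ext <;> simp
  have h2 : imPart (conjCoeff w) = -imPart w := by ext <;> simp
  simp [evalAt, h1, h2]

theorem ext_parts {v w : ℍ[ℂ]} (h1 : rePart v = rePart w) (h2 : imPart v = imPart w) : v = w := by
  simp only [Quaternion.ext_iff, rePart_re, rePart_imI, rePart_imJ, rePart_imK, imPart_re,
    imPart_imI, imPart_imJ, imPart_imK] at h1 h2
  ext1
  · exact Complex.ext h1.1 h2.1
  · exact Complex.ext h1.2.1 h2.2.1
  · exact Complex.ext h1.2.2.1 h2.2.2.1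
  · exact Complex.ext h1.2.2.2 h2.2.2.2

/-- The form is complex bilinear rather than Hermitian, so it has nonzero isotropic vectors: those
with `|a| = |b|` and `a ⊥ b`. -/
theorem normSq_eq_parts (w : ℍ[ℂ]) : Quaternion.normSq w =
    ⟨Quaternion.normSq (rePart w) - Quaternion.normSq (imPart w),
      2 * (rePart w * star (imPart w)).re⟩ := by
  simp only [Quaternion.normSq_def']
  apply Complex.ext <;> simp [pow_two] <;> ring

/-- A zero of the norm form comes from a zero on the sphere. -/
theorem exists_evalAt_eq_zero {w : ℍ[ℂ]} (hw : Quaternion.normSq w = 0) :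
    ∃ I ∈ imagUnits, evalAt I w = 0 := by
  rw [normSq_eq_parts, Complex.ext_iff] at hw
  simp only [Complex.zero_re, Complex.zero_im] at hw
  obtain ⟨h1, h2⟩ := hw
  by_cases hb : imPart w = 0
  · rw [hb] at h1
    have ha : rePart w = 0 := by simpa using h1
    exact ⟨_, unitI_mem_imagUnits, by simp [evalAt, ha, hb]⟩
  · have hn : Quaternion.normSq (imPart w) ≠ 0 := Quaternion.normSq_ne_zero.2 hb
    -- Solving `a + I b = 0` forces `I = -a b⁻¹`. It has norm one because `|a| = |b|`, and real part
    -- zero because `a ⊥ b`.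
    have hI : (-(rePart w * (imPart w)⁻¹)) * imPart w = - rePart w := by
      rw [neg_mul, mul_assoc, inv_mul_cancel₀ hb, mul_one]
    refine ⟨-(rePart w * (imPart w)⁻¹), ?_, by rw [evalAt, hI, add_neg_cancel]⟩
    have hr : (-(rePart w * (imPart w)⁻¹)).re = 0 := by
      rw [Quaternion.inv_def, mul_smul_comm, Quaternion.re_neg, Quaternion.re_smul]
      simp only [smul_eq_mul]
      rw [show (rePart w * star (imPart w)).re = 0 by linarith]
      simp
    have hq : Quaternion.normSq (-(rePart w * (imPart w)⁻¹)) = 1 := by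
      rw [Quaternion.normSq_neg, map_mul, Quaternion.normSq_inv, sub_eq_zero.1 h1,
        mul_inv_cancel₀ hn]
    rw [mem_imagUnits_iff]
    rw [Quaternion.normSq_def', hr] at hq
    exact ⟨hr, by linarith⟩

theorem normSq_eq_zero_of_evalAt {I : ℍ[ℝ]} (hI : I ∈ imagUnits) {w : ℍ[ℂ]}
    (h : evalAt I w = 0) : Quaternion.normSq w = 0 := by
  have hA : rePart w = -(I * imPart w) := eq_neg_of_add_eq_zero_left h
  obtain ⟨h0, h1⟩ := mem_imagUnits_iff.1 hI
  rw [normSq_eq_parts, hA]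
  apply Complex.ext
  · rw [Quaternion.normSq_neg, map_mul, Quaternion.normSq_def', h0]
    simp only [Complex.zero_re]
    linear_combination Quaternion.normSq (imPart w) * h1
  · rw [neg_mul, mul_assoc, Quaternion.self_mul_star, Quaternion.re_neg, Quaternion.re_mul]
    simp [h0]

/-- For `z = x + i y` the first factor is `y (i + I)`, while `a = -I b` gives `w = (i - I) b`. As
`i` is central, `(i + I)(i - I) = i² - I² = 0`. -/
theorem complexify_star_sub_mul {I : ℍ[ℝ]} (hI : I ∈ imagUnits) {w : ℍ[ℂ]}
    (h : evalAt I w = 0) (z : ℂ) :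
    ((z : ℍ[ℂ]) - complexify (star (sliceMap I z))) * w = 0 := by
  have hA : rePart w = -(I * imPart w) := eq_neg_of_add_eq_zero_left h
  have hII := mul_self_of_mem_imagUnits hI
  have h1 : rePart ((z : ℍ[ℂ]) - complexify (star (sliceMap I z))) = z.im • I := by
    have := (mem_imagUnits_iff.1 hI).1
    ext <;> simp [sliceMap, this, mul_comm]
  have h2 : imPart ((z : ℍ[ℂ]) - complexify (star (sliceMap I z))) = z.im • 1 := by
    ext <;> simp [sliceMap]
  apply ext_parts
  · rw [rePart_mul, h1, h2, hA]
    simp only [smul_mul_assoc, mul_neg, ← mul_assoc, hII]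
    ext <;> simp
  · rw [imPart_mul, h1, h2, hA]
    simp only [smul_mul_assoc, mul_neg, ← mul_assoc, one_mul]
    ext <;> simp

/-- Since `|I b| = |b|`, the parallelogram law makes `|a|² + |b|²` the mean of the squared norms of
`a + I b` and `a - I b`. -/
theorem normSq_parts_le (w : ℍ[ℂ]) {I : ℍ[ℝ]} (hI : I ∈ imagUnits) :
    ‖Quaternion.normSq w‖ ≤ max ‖evalAt I w‖ ‖evalAt (-I) w‖ ^ 2 := by
  have hpar : ‖evalAt I w‖ ^ 2 + ‖evalAt (-I) w‖ ^ 2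
      = 2 * (‖rePart w‖ ^ 2 + ‖imPart w‖ ^ 2) := by
    obtain ⟨h0, h1⟩ := mem_imagUnits_iff.1 hI
    have h2 : ‖imPart w‖ ^ 2 = ‖I * imPart w‖ ^ 2 := by
      rw [norm_mul, norm_of_mem_imagUnits hI, one_mul]
    rw [h2, evalAt, evalAt, norm_sq_eq, norm_sq_eq, norm_sq_eq, norm_sq_eq, neg_mul]
    simp only [Quaternion.re_add, Quaternion.imI_add, Quaternion.imJ_add, Quaternion.imK_add,
      Quaternion.re_neg, Quaternion.imI_neg, Quaternion.imJ_neg, Quaternion.imK_neg]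
    ring
  have hle : ‖Quaternion.normSq w‖ ≤ ‖rePart w‖ ^ 2 + ‖imPart w‖ ^ 2 := by
    rw [Quaternion.normSq_def', norm_sq_eq, norm_sq_eq]
    refine (norm_add_le _ _).trans ?_
    refine (add_le_add_left ((norm_add_le _ _).trans
      (add_le_add_left (norm_add_le _ _) _)) _).trans ?_
    simp only [norm_pow, Complex.sq_norm, Complex.normSq_apply, rePart_re, rePart_imI, rePart_imJ, rePart_imK,
      imPart_re, imPart_imI, imPart_imJ, imPart_imK]
    apply le_of_eq; ring
  have h1 : ‖evalAt I w‖ ^ 2 ≤ max ‖evalAt I w‖ ‖evalAt (-I) w‖ ^ 2 :=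
    pow_le_pow_left₀ (norm_nonneg _) (le_max_left _ _) 2
  have h2 : ‖evalAt (-I) w‖ ^ 2 ≤ max ‖evalAt I w‖ ‖evalAt (-I) w‖ ^ 2 :=
    pow_le_pow_left₀ (norm_nonneg _) (le_max_right _ _) 2
  linarith

/-! ### Holomorphic stem functions and the functions they induce -/

/-- The components of `h : ℂ → ℍ ⊗ ℂ` are holomorphic on the unit disc. -/
structure IsHol (h : ℂ → ℍ[ℂ]) : Prop where
  re : DifferentiableOn ℂ (fun z => (h z).re) (Metric.ball 0 1)
  imI : DifferentiableOn ℂ (fun z => (h z).imI) (Metric.ball 0 1)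
  imJ : DifferentiableOn ℂ (fun z => (h z).imJ) (Metric.ball 0 1)
  imK : DifferentiableOn ℂ (fun z => (h z).imK) (Metric.ball 0 1)

/-- A holomorphic stem function on the unit disc. -/
structure IsStem (h : ℂ → ℍ[ℂ]) : Prop extends IsHol h where
  symm : ∀ z ∈ Metric.ball (0 : ℂ) 1, h (conj z) = conjCoeff (h z)

/-- The quaternionic function `f` is induced by the stem function `h`. -/
def Induces (h : ℂ → ℍ[ℂ]) (f : ℍ[ℝ] → ℍ[ℝ]) : Prop :=
  ∀ I ∈ imagUnits, ∀ z ∈ Metric.ball (0 : ℂ) 1, f (sliceMap I z) = evalAt I (h z)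

/-- The quaternionic function induced by a stem function. -/
noncomputable def induced (h : ℂ → ℍ[ℂ]) (q : ℍ[ℝ]) : ℍ[ℝ] :=
  evalAt (unitIm q) (h ⟨q.re, ‖q.im‖⟩)

theorem conj_mem_ball {z : ℂ} (hz : z ∈ Metric.ball (0 : ℂ) 1) :
    conj z ∈ Metric.ball (0 : ℂ) 1 := by
  simpa using hz

theorem IsHol.mul {g h : ℂ → ℍ[ℂ]} (hg : IsHol g) (hh : IsHol h) :
    IsHol (fun z => g z * h z) where
  re := by
    simp only [Quaternion.re_mul]
    exact (((hg.re.mul hh.re).sub (hg.imI.mul hh.imI)).sub (hg.imJ.mul hh.imJ)).sub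
      (hg.imK.mul hh.imK)
  imI := by
    simp only [Quaternion.imI_mul]
    exact (((hg.re.mul hh.imI).add (hg.imI.mul hh.re)).add (hg.imJ.mul hh.imK)).sub
      (hg.imK.mul hh.imJ)
  imJ := by
    simp only [Quaternion.imJ_mul]
    exact (((hg.re.mul hh.imJ).sub (hg.imI.mul hh.imK)).add (hg.imJ.mul hh.re)).add
      (hg.imK.mul hh.imI)
  imK := by
    simp only [Quaternion.imK_mul]
    exact (((hg.re.mul hh.imK).add (hg.imI.mul hh.imJ)).sub (hg.imJ.mul hh.imI)).add
      (hg.imK.mul hh.re)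

theorem IsStem.mul {g h : ℂ → ℍ[ℂ]} (hg : IsStem g) (hh : IsStem h) :
    IsStem (fun z => g z * h z) where
  toIsHol := hg.toIsHol.mul hh.toIsHol
  symm z hz := by rw [hg.symm z hz, hh.symm z hz, conjCoeff_mul]

theorem isStem_coe_sub_complexify (p : ℍ[ℝ]) :
    IsStem (fun z => (z : ℍ[ℂ]) - complexify p) where
  re := by simpa using differentiable_fun_id.differentiableOn
  imI := by simp
  imJ := by simp
  imK := by simp
  symm z _ := by ext <;> simp

theorem IsHol.differentiableOn_normSq {h : ℂ → ℍ[ℂ]} (hh : IsHol h) :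
    DifferentiableOn ℂ (fun z => Quaternion.normSq (h z)) (Metric.ball 0 1) := by
  simp only [Quaternion.normSq_def']
  exact (((hh.re.pow 2).add (hh.imI.pow 2)).add (hh.imJ.pow 2)).add (hh.imK.pow 2)

theorem IsStem.imPart_eq_zero {h : ℂ → ℍ[ℂ]} (hh : IsStem h) {x : ℝ}
    (hx : (x : ℂ) ∈ Metric.ball (0 : ℂ) 1) : imPart (h x) = 0 := by
  have := hh.symm x hx
  rw [Complex.conj_ofReal, Quaternion.ext_iff] at this
  simp only [conjCoeff_re, conjCoeff_imI, conjCoeff_imJ, conjCoeff_imK] at this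
  ext
  · exact Complex.conj_eq_iff_im.1 this.1.symm
  · exact Complex.conj_eq_iff_im.1 this.2.1.symm
  · exact Complex.conj_eq_iff_im.1 this.2.2.1.symm
  · exact Complex.conj_eq_iff_im.1 this.2.2.2.symm

/-- `unitIm` selects the presentation with `y ≥ 0`, so `induced` and `starMul` are computed directly
only there; symmetry gives the other half. -/
theorem induces_of_im_nonneg {h : ℂ → ℍ[ℂ]} (hh : IsStem h) {f : ℍ[ℝ] → ℍ[ℝ]}
    (H : ∀ I ∈ imagUnits, ∀ z ∈ Metric.ball (0 : ℂ) 1, 0 ≤ z.im →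
      f (sliceMap I z) = evalAt I (h z)) : Induces h f := by
  intro I hI z hz
  rcases le_total 0 z.im with h0 | h0
  · exact H I hI z hz h0
  · rw [← sliceMap_neg_conj, H _ (neg_mem_imagUnits hI) _ (conj_mem_ball hz) (by simpa using h0),
      hh.symm z hz, evalAt_neg_conjCoeff]

theorem unitIm_sliceMap_of_im_eq_zero {I : ℍ[ℝ]} (hI : I ∈ imagUnits) {z : ℂ} (hz : z.im = 0) :
    unitIm (sliceMap I z) = 0 := by
  simp [unitIm, im_sliceMap hI, hz]

theorem IsStem.imPart_eq_zero' {h : ℂ → ℍ[ℂ]} (hh : IsStem h) {z : ℂ}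
    (hz : z ∈ Metric.ball (0 : ℂ) 1) (h0 : z.im = 0) : imPart (h z) = 0 := by
  obtain ⟨x, rfl⟩ : ∃ x : ℝ, (x : ℂ) = z := ⟨z.re, Complex.ext (by simp) (by simp [h0])⟩
  exact hh.imPart_eq_zero hz

theorem IsStem.induces_induced {h : ℂ → ℍ[ℂ]} (hh : IsStem h) : Induces h (induced h) := by
  refine induces_of_im_nonneg hh fun I hI z hz h0 => ?_
  rw [induced, re_sliceMap hI, norm_im_sliceMap hI, abs_of_nonneg h0]
  rcases h0.eq_or_lt with h1 | h1
  -- At real points `unitIm` takes the value `0` instead of `I`, which is harmless because `b`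
  -- vanishes there.
  · simp [evalAt, hh.imPart_eq_zero' hz h1.symm]
  · rw [unitIm_sliceMap hI h1]

theorem stemRe_eq {h : ℂ → ℍ[ℂ]} {f : ℍ[ℝ] → ℍ[ℝ]} (hf : Induces h f) {I : ℍ[ℝ]}
    (hI : I ∈ imagUnits) {z : ℂ} (hz : z ∈ Metric.ball (0 : ℂ) 1) :
    stemRe f (sliceMap I z) = rePart (h z) := by
  rw [stemRe, ← sliceMap_conj hI, ← sliceMap_neg_conj I (conj z), Complex.conj_conj, hf I hI z hz,
    hf _ (neg_mem_imagUnits hI) z hz, evalAt, evalAt, neg_mul, add_add_add_comm, add_neg_cancel,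
    add_zero, ← two_smul ℝ, smul_smul]
  norm_num

theorem stemIm_eq {h : ℂ → ℍ[ℂ]} {f : ℍ[ℝ] → ℍ[ℝ]} (hh : IsStem h) (hf : Induces h f) {I : ℍ[ℝ]}
    (hI : I ∈ imagUnits) {z : ℂ} (hz : z ∈ Metric.ball (0 : ℂ) 1) (h0 : 0 ≤ z.im) :
    stemIm f (sliceMap I z) = imPart (h z) := by
  rw [stemIm]
  rcases h0.eq_or_lt with h1 | h1
  · rw [hh.imPart_eq_zero' hz h1.symm, unitIm_sliceMap_of_im_eq_zero hI h1.symm, zero_mul, neg_zero]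
  · rw [unitIm_sliceMap hI h1, ← sliceMap_conj hI, ← sliceMap_neg_conj I (conj z),
      Complex.conj_conj, hf I hI z hz, hf _ (neg_mem_imagUnits hI) z hz, evalAt, evalAt, neg_mul,
      ← sub_eq_add_neg, add_sub_sub_cancel, ← two_smul ℝ, smul_smul, mul_smul_comm, ← mul_assoc,
      mul_self_of_mem_imagUnits hI]
    norm_num

theorem Induces.starMul {g h : ℂ → ℍ[ℂ]} {F G : ℍ[ℝ] → ℍ[ℝ]} (hg : IsStem g) (hh : IsStem h)
    (hF : Induces g F) (hG : Induces h G) : Induces (fun z => g z * h z) (starMul F G) := by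
  refine induces_of_im_nonneg (hg.mul hh) fun I hI z hz h0 => ?_
  rw [QuaternionHardy.starMul, stemRe_eq hF hI hz, stemRe_eq hG hI hz, stemIm_eq hg hF hI hz h0,
    stemIm_eq hh hG hI hz h0, evalAt, rePart_mul, imPart_mul]
  rcases h0.eq_or_lt with h1 | h1
  · simp [hg.imPart_eq_zero' hz h1.symm, hh.imPart_eq_zero' hz h1.symm]
  · rw [unitIm_sliceMap hI h1]

theorem induces_sub (p : ℍ[ℝ]) : Induces (fun z => (z : ℍ[ℂ]) - complexify p) (fun q => q - p) := by
  intro I hI z _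
  have h1 : rePart ((z : ℍ[ℂ]) - complexify p) = z.re - p := by ext <;> simp
  have h2 : imPart ((z : ℍ[ℂ]) - complexify p) = z.im := by ext <;> simp
  rw [evalAt, h1, h2, sliceMap, ← Quaternion.coe_commutes,
    sub_add_eq_add_sub]

theorem sliceMap_mul {I : ℍ[ℝ]} (hI : I ∈ imagUnits) (z w : ℂ) :
    sliceMap I (z * w) = sliceMap I z * sliceMap I w := by
  have key : ∀ c : ℂ, evalAt I (c • 1) = sliceMap I c := fun c => by
    have h1 : rePart (c • 1) = c.re := by ext <;> simp
    have h2 : imPart (c • 1) = c.im := by ext <;> simp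
    rw [evalAt, h1, h2, sliceMap, ← Quaternion.coe_commutes]
  rw [← key (z * w), mul_smul, evalAt_smul hI, key]

theorem sliceMap_add (I : ℍ[ℝ]) (z w : ℂ) : sliceMap I (z + w) = sliceMap I z + sliceMap I w := by
  simp only [sliceMap, Complex.add_re, Complex.add_im, Quaternion.coe_add, add_mul]
  exact add_add_add_comm _ _ _ _

theorem sliceMap_pow {I : ℍ[ℝ]} (hI : I ∈ imagUnits) (z : ℂ) (n : ℕ) :
    sliceMap I (z ^ n) = sliceMap I z ^ n := by
  induction n with
  | zero => simp [sliceMap]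
  | succ n ih => rw [pow_succ, sliceMap_mul hI, ih, pow_succ]

theorem sliceMap_sub_ofReal (I : ℍ[ℝ]) (z : ℂ) (x : ℝ) :
    sliceMap I (z - x) = sliceMap I z - (x : ℍ[ℝ]) := by
  rw [sub_eq_add_neg, ← Complex.ofReal_neg, sliceMap_add, sliceMap_ofReal]
  simp [sub_eq_add_neg]

/-! ### Slice regularity is equivalent to having a holomorphic stem function -/

/-- `c ↦ φ_I(c) e`, where `φ_I` identifies `ℂ` with the slice `L_I`, as a real linear map. -/
noncomputable def sliceMulCLM (I e : ℍ[ℝ]) : ℂ →L[ℝ] ℍ[ℝ] :=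
  Complex.reCLM.smulRight e + Complex.imCLM.smulRight (I * e)

theorem sliceMulCLM_apply (I e : ℍ[ℝ]) (c : ℂ) : sliceMulCLM I e c = c.re • e + c.im • (I * e) := rfl

/-- Multiplication by `i` turns into left multiplication by `I`, so the Cauchy–Riemann equation for
a component becomes `∂̄_I = 0`. -/
theorem sliceMulCLM_I_mul {I : ℍ[ℝ]} (hI : I ∈ imagUnits) (e : ℍ[ℝ]) (c : ℂ) :
    sliceMulCLM I e (Complex.I * c) = I * sliceMulCLM I e c := by
  simp only [sliceMulCLM_apply, mul_add, mul_smul_comm, ← mul_assoc, mul_self_of_mem_imagUnits hI]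
  simp only [Complex.mul_re, Complex.mul_im, Complex.I_re, Complex.I_im, zero_mul, one_mul, zero_sub,
    zero_add, neg_mul, smul_neg, neg_smul]
  module

/-- The quaternion unit `j`. -/
noncomputable def unitJ : ℍ[ℝ] := ⟨0, 0, 1, 0⟩
@[simp] theorem unitJ_re : unitJ.re = 0 := rfl
@[simp] theorem unitJ_imI : unitJ.imI = 0 := rfl
@[simp] theorem unitJ_imJ : unitJ.imJ = 1 := rfl
@[simp] theorem unitJ_imK : unitJ.imK = 0 := rfl

/-- The quaternion unit `k`. -/
noncomputable def unitK : ℍ[ℝ] := ⟨0, 0, 0, 1⟩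
@[simp] theorem unitK_re : unitK.re = 0 := rfl
@[simp] theorem unitK_imI : unitK.imI = 0 := rfl
@[simp] theorem unitK_imJ : unitK.imJ = 0 := rfl
@[simp] theorem unitK_imK : unitK.imK = 1 := rfl

theorem evalAt_eq_sum (I : ℍ[ℝ]) (w : ℍ[ℂ]) :
    evalAt I w = sliceMulCLM I 1 w.re + sliceMulCLM I unitI w.imI + sliceMulCLM I unitJ w.imJ
      + sliceMulCLM I unitK w.imK := by
  simp only [evalAt, sliceMulCLM_apply]
  ext <;> simp <;> ring

theorem sliceMulCLM_comp {I : ℍ[ℝ]} (hI : I ∈ imagUnits) (e : ℍ[ℝ]) {u : ℂ → ℂ}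
    (hu : DifferentiableOn ℂ u (Metric.ball 0 1)) {z : ℂ} (hz : z ∈ Metric.ball (0 : ℂ) 1) :
    ∃ L : ℂ →L[ℝ] ℍ[ℝ], HasFDerivAt (fun w => sliceMulCLM I e (u w)) L z ∧
      L Complex.I = I * L 1 := by
  have hd := (hu.differentiableAt (Metric.isOpen_ball.mem_nhds hz)).hasDerivAt
  refine ⟨_, (sliceMulCLM I e).hasFDerivAt.comp z hd.complexToReal_fderiv, ?_⟩
  simp only [ContinuousLinearMap.comp_apply, smul_apply, one_apply_eq_self, smul_eq_mul, mul_one]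
  rw [mul_comm, sliceMulCLM_I_mul hI]

theorem IsHol.exists_hasFDerivAt {h : ℂ → ℍ[ℂ]} (hh : IsHol h) {I : ℍ[ℝ]} (hI : I ∈ imagUnits)
    {z : ℂ} (hz : z ∈ Metric.ball (0 : ℂ) 1) :
    ∃ L : ℂ →L[ℝ] ℍ[ℝ], HasFDerivAt (fun w => evalAt I (h w)) L z ∧ L Complex.I = I * L 1 := by
  obtain ⟨L₀, h₀, e₀⟩ := sliceMulCLM_comp hI 1 hh.re hz
  obtain ⟨L₁, h₁, e₁⟩ := sliceMulCLM_comp hI unitI hh.imI hz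
  obtain ⟨L₂, h₂, e₂⟩ := sliceMulCLM_comp hI unitJ hh.imJ hz
  obtain ⟨L₃, h₃, e₃⟩ := sliceMulCLM_comp hI unitK hh.imK hz
  simp only [evalAt_eq_sum]
  refine ⟨_, ((h₀.add h₁).add h₂).add h₃, ?_⟩
  simp [e₀, e₁, e₂, e₃, mul_add]

theorem Induces.sliceRegular {h : ℂ → ℍ[ℂ]} {f : ℍ[ℝ] → ℍ[ℝ]} (hh : IsHol h) (hf : Induces h f) :
    SliceRegular f := by
  intro I hI
  have hc : ∀ (e : ℍ[ℝ]) (u : ℂ → ℂ), DifferentiableOn ℂ u (Metric.ball 0 1) →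
      ContDiffOn ℝ 1 (fun w => sliceMulCLM I e (u w)) (Metric.ball 0 1) := fun e u hu =>
    (sliceMulCLM I e).contDiff.comp_contDiffOn
      ((hu.contDiffOn Metric.isOpen_ball).restrict_scalars ℝ)
  refine ⟨?_, fun z hz => ?_⟩
  · refine ContDiffOn.congr ?_ (hf I hI)
    simp only [evalAt_eq_sum]
    exact (((hc _ _ hh.re).add (hc _ _ hh.imI)).add (hc _ _ hh.imJ)).add (hc _ _ hh.imK)
  · obtain ⟨L, hL, e⟩ := hh.exists_hasFDerivAt hI hz
    have hev : (fun w => f (sliceMap I w)) =ᶠ[𝓝 z] fun w => evalAt I (h w) :=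
      Filter.eventuallyEq_of_mem (Metric.isOpen_ball.mem_nhds hz) (hf I hI)
    rw [dbar, (hL.congr_of_eventuallyEq hev).fderiv, e, ← mul_assoc, mul_self_of_mem_imagUnits hI]
    simp

/-- The identity theorem applies because real points accumulate at `0`. -/
theorem eqOn_zero_of_forall_real {u : ℂ → ℂ} (hu : DifferentiableOn ℂ u (Metric.ball 0 1))
    (h0 : ∀ x : ℝ, (x : ℂ) ∈ Metric.ball (0 : ℂ) 1 → u x = 0) :
    ∀ z ∈ Metric.ball (0 : ℂ) 1, u z = 0 := by
  have ha := hu.analyticOnNhd Metric.isOpen_ball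
  have ht : Tendsto (fun x : ℝ => (x : ℂ)) (𝓝[≠] 0) (𝓝[≠] 0) := by
    refine tendsto_nhdsWithin_of_tendsto_nhds_of_eventually_within _ ?_ ?_
    · have := (Complex.continuous_ofReal.tendsto 0).mono_left
        (nhdsWithin_le_nhds (s := ({0}ᶜ : Set ℝ)))
      simpa using this
    · filter_upwards [self_mem_nhdsWithin] with x hx
      simpa using hx
  have hf : ∃ᶠ z in 𝓝[≠] (0 : ℂ), u z = 0 := by
    refine ht.frequently (Eventually.frequently ?_)
    have : ∀ᶠ z in 𝓝[≠] (0 : ℂ), z ∈ Metric.ball (0 : ℂ) 1 :=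
      nhdsWithin_le_nhds (Metric.ball_mem_nhds _ one_pos)
    filter_upwards [ht.eventually this] with x hx using h0 x hx
  exact fun z hz => ha.eqOn_zero_of_preconnected_of_frequently_eq_zero
    (convex_ball _ _).isPreconnected (Metric.mem_ball_self one_pos) hf hz

/-- If `D` is killed by `∂̄_I`, its left `I`-linear functionals are holomorphic. -/
theorem differentiableAt_sub_mul_I {I : ℍ[ℝ]} (hI : I ∈ imagUnits) {D : ℂ → ℍ[ℝ]} {z : ℂ}
    {L : ℂ →L[ℝ] ℍ[ℝ]} (hD : HasFDerivAt D L z) (hL : L 1 + I * L Complex.I = 0)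
    (l : ℍ[ℝ] →L[ℝ] ℝ) :
    DifferentiableAt ℂ (fun w => (l (D w) : ℂ) - l (I * D w) * Complex.I) z := by
  have h1 := Complex.ofRealCLM.hasFDerivAt.comp z (l.hasFDerivAt.comp z hD)
  have h2 := Complex.ofRealCLM.hasFDerivAt.comp z
    (l.hasFDerivAt.comp z ((ContinuousLinearMap.mul ℝ ℍ[ℝ] I).hasFDerivAt.comp z hD))
  have h3 := h1.sub (h2.mul_const Complex.I)
  -- Writing `D_y = I D_x`, the derivative along `i` is `l(I D_x) + i l(D_x) = i (l(D_x) - i l(I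
  -- D_x))`, which is the Cauchy–Riemann equation.
  refine differentiableAt_complex_iff_differentiableAt_real.2 ⟨h3.differentiableAt, ?_⟩
  have hL' : L Complex.I = I * L 1 := by
    rw [eq_neg_of_add_eq_zero_left hL, mul_neg, ← mul_assoc, mul_self_of_mem_imagUnits hI]
    simp
  have hL'' : I * L Complex.I = -L 1 := by
    rw [hL', ← mul_assoc, mul_self_of_mem_imagUnits hI, neg_one_mul]
  have h4 : fderiv ℝ (fun w => (l (D w) : ℂ) - l (I * D w) * Complex.I) z = _ := h3.fderiv
  rw [h4]
  simp [hL', ← mul_assoc, mul_self_of_mem_imagUnits hI]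
  linear_combination (l (I * L 1) : ℂ) * Complex.I_mul_I

/-- Two functions of a slice killed by `∂̄_I` that agree on the real axis are equal. -/
theorem eq_zero_of_forall_real {I : ℍ[ℝ]} (hI : I ∈ imagUnits) {D : ℂ → ℍ[ℝ]}
    (hD : ∀ z ∈ Metric.ball (0 : ℂ) 1, ∃ L : ℂ →L[ℝ] ℍ[ℝ], HasFDerivAt D L z ∧
      L 1 + I * L Complex.I = 0)
    (h0 : ∀ x : ℝ, (x : ℂ) ∈ Metric.ball (0 : ℂ) 1 → D x = 0) :
    ∀ z ∈ Metric.ball (0 : ℂ) 1, D z = 0 := by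
  have key : ∀ l : ℍ[ℝ] →L[ℝ] ℝ, ∀ z ∈ Metric.ball (0 : ℂ) 1, l (D z) = 0 := by
    intro l z hz
    have := eqOn_zero_of_forall_real (u := fun w => (l (D w) : ℂ) - l (I * D w) * Complex.I)
      (fun w hw => by
        obtain ⟨L, h1, h2⟩ := hD w hw
        exact (differentiableAt_sub_mul_I hI h1 h2 l).differentiableWithinAt)
      (fun x hx => by simp [h0 x hx]) z hz
    simpa using congrArg Complex.re this
  intro z hz
  by_contra hne
  obtain ⟨l, hl⟩ := SeparatingDual.exists_ne_zero (R := ℝ) hne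
  exact hl (key l z hz)

theorem SliceRegular.exists_hasFDerivAt {f : ℍ[ℝ] → ℍ[ℝ]} (hf : SliceRegular f) {I : ℍ[ℝ]}
    (hI : I ∈ imagUnits) {z : ℂ} (hz : z ∈ Metric.ball (0 : ℂ) 1) :
    ∃ L : ℂ →L[ℝ] ℍ[ℝ], HasFDerivAt (fun w => f (sliceMap I w)) L z ∧
      L 1 + I * L Complex.I = 0 := by
  obtain ⟨h1, h2⟩ := hf I hI
  refine ⟨_, ((h1.differentiableOn one_ne_zero).differentiableAt
    (Metric.isOpen_ball.mem_nhds hz)).hasFDerivAt, ?_⟩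
  have := h2 z hz
  rw [dbar] at this
  exact (smul_eq_zero.1 this).resolve_left (by norm_num)

theorem differentiableOn_conj_conj {u : ℂ → ℂ} (hu : DifferentiableOn ℂ u (Metric.ball 0 1)) :
    DifferentiableOn ℂ (fun z => conj (u (conj z))) (Metric.ball 0 1) := by
  intro z hz
  have h := (hu.differentiableAt (Metric.isOpen_ball.mem_nhds (conj_mem_ball hz))).conj_conj
  rw [Complex.conj_conj] at h
  exact h.differentiableWithinAt

/-- Every slice regular function on the ball is induced by a holomorphic stem function. -/
theorem SliceRegular.exists_stem {f : ℍ[ℝ] → ℍ[ℝ]} (hf : SliceRegular f) :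
    ∃ h, IsStem h ∧ Induces h f := by
  have hdiff : ∀ l : ℍ[ℝ] →L[ℝ] ℝ, DifferentiableOn ℂ (fun w => (l (f (sliceMap unitI w)) : ℂ)
      - l (unitI * f (sliceMap unitI w)) * Complex.I) (Metric.ball 0 1) := fun l w hw => by
    obtain ⟨L, h1, h2⟩ := hf.exists_hasFDerivAt unitI_mem_imagUnits hw
    exact (differentiableAt_sub_mul_I unitI_mem_imagUnits h1 h2 l).differentiableWithinAt
  let F : ℂ → ℂ := fun w => ⟨(f (sliceMap unitI w)).re, (f (sliceMap unitI w)).imI⟩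
  let G : ℂ → ℂ := fun w => ⟨(f (sliceMap unitI w)).imJ, (f (sliceMap unitI w)).imK⟩
  -- This is the splitting `f = F + G j` on the slice of `i`. The functionals `re` and `imJ` yield
  -- `F` and `G`, as `re (i q) = -imI q` and `imJ (i q) = -imK q`.
  have hF : DifferentiableOn ℂ F (Metric.ball 0 1) := by
    refine (hdiff ⟨⟨⟨fun q => q.re, fun _ _ => rfl⟩, fun _ _ => rfl⟩,
      Quaternion.continuous_re⟩).congr fun w _ => ?_
    apply Complex.ext
    · simp [F]; rfl
    · simp [F]
      exact (by simp : (f (sliceMap unitI w)).imI = -(unitI * f (sliceMap unitI w)).re)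
  have hG : DifferentiableOn ℂ G (Metric.ball 0 1) := by
    refine (hdiff ⟨⟨⟨fun q => q.imJ, fun _ _ => rfl⟩, fun _ _ => rfl⟩,
      Quaternion.continuous_imJ⟩).congr fun w _ => ?_
    apply Complex.ext
    · simp [G]; rfl
    · simp [G]
      exact (by simp : (f (sliceMap unitI w)).imK = -(unitI * f (sliceMap unitI w)).imJ)
  have hF0 : ∀ w, F w = ⟨(f (sliceMap unitI w)).re, (f (sliceMap unitI w)).imI⟩ := fun _ => rfl
  have hG0 : ∀ w, G w = ⟨(f (sliceMap unitI w)).imJ, (f (sliceMap unitI w)).imK⟩ := fun _ => rfl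
  clear_value F G
  have hF' := differentiableOn_conj_conj hF
  have hG' := differentiableOn_conj_conj hG
  -- The components must satisfy `F = h₀ + i h₁` and `G = h₂ + i h₃`. By symmetry the reflection of
  -- `F` is `h₀ - i h₁`, and likewise for `G`; solving gives these formulas.
  let h : ℂ → ℍ[ℂ] := fun z =>
    ⟨(F z + conj (F (conj z))) / 2, -Complex.I * (F z - conj (F (conj z))) / 2,
      (G z + conj (G (conj z))) / 2, -Complex.I * (G z - conj (G (conj z))) / 2⟩
  have h0 : ∀ z, (h z).re = (F z + conj (F (conj z))) / 2 := fun _ => rfl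
  have h1 : ∀ z, (h z).imI = -Complex.I * (F z - conj (F (conj z))) / 2 := fun _ => rfl
  have h2 : ∀ z, (h z).imJ = (G z + conj (G (conj z))) / 2 := fun _ => rfl
  have h3 : ∀ z, (h z).imK = -Complex.I * (G z - conj (G (conj z))) / 2 := fun _ => rfl
  clear_value h
  have hh : IsStem h :=
    { re := by simp only [h0]; exact (hF.add hF').div_const 2
      imI := by simp only [h1]; exact ((hF.sub hF').const_mul _).div_const 2
      imJ := by simp only [h2]; exact (hG.add hG').div_const 2
      imK := by simp only [h3]; exact ((hG.sub hG').const_mul _).div_const 2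
      symm := fun z _ => by
        ext1 <;> simp only [h0, h1, h2, h3, conjCoeff_re, conjCoeff_imI, conjCoeff_imJ,
          conjCoeff_imK, map_div₀, map_mul, map_add, map_sub, map_neg, Complex.conj_conj,
          Complex.conj_I, map_ofNat] <;> ring }
  refine ⟨h, hh, fun I hI z hz => ?_⟩
  -- `h` is built from one slice only. On any other slice, `f` and the induced function agree on the
  -- real axis, hence everywhere.
  refine sub_eq_zero.1 (eq_zero_of_forall_real hI
    (D := fun w => f (sliceMap I w) - evalAt I (h w)) (fun w hw => ?_) (fun x hx => ?_) z hz)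
  · obtain ⟨L, hL, eL⟩ := hf.exists_hasFDerivAt hI hw
    obtain ⟨M, hM, eM⟩ := hh.exists_hasFDerivAt hI hw
    refine ⟨_, hL.sub hM, ?_⟩
    simp only [sub_apply]
    rw [mul_sub, sub_add_sub_comm, eL, eM, ← mul_assoc, mul_self_of_mem_imagUnits hI]
    simp
  · rw [evalAt, hh.imPart_eq_zero hx, mul_zero, add_zero, sliceMap_ofReal, sub_eq_zero]
    ext <;> simp [h0, h1, h2, h3, hF0, hG0, sliceMap_ofReal]

/-! ### Division of stem functions and the order of the norm form -/

/-- The vanishing order at `z` of the norm form of a stem function. -/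
noncomputable abbrev stemOrder (h : ℂ → ℍ[ℂ]) (z : ℂ) : ℕ∞ :=
  analyticOrderAt (fun w => Quaternion.normSq (h w)) z

theorem IsHol.analyticAt_normSq {h : ℂ → ℍ[ℂ]} (hh : IsHol h) {z : ℂ}
    (hz : z ∈ Metric.ball (0 : ℂ) 1) : AnalyticAt ℂ (fun w => Quaternion.normSq (h w)) z :=
  hh.differentiableOn_normSq.analyticOnNhd Metric.isOpen_ball z hz

theorem IsHol.exists_eq_sub_smul {h : ℂ → ℍ[ℂ]} (hh : IsHol h) {c : ℂ}
    (hc : c ∈ Metric.ball (0 : ℂ) 1) (h0 : h c = 0) :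
    ∃ k, IsHol k ∧ ∀ z, h z = (z - c) • k z := by
  have key : ∀ {u : ℂ → ℂ}, DifferentiableOn ℂ u (Metric.ball 0 1) →
      DifferentiableOn ℂ (dslope u c) (Metric.ball 0 1) := fun hu =>
    (Complex.differentiableOn_dslope (Metric.isOpen_ball.mem_nhds hc)).2 hu
  refine ⟨fun z => ⟨dslope (fun w => (h w).re) c z, dslope (fun w => (h w).imI) c z,
    dslope (fun w => (h w).imJ) c z, dslope (fun w => (h w).imK) c z⟩,
    ⟨key hh.re, key hh.imI, key hh.imJ, key hh.imK⟩, fun z => ?_⟩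
  ext1
  · exact (by rw [sub_smul_dslope, h0]; simp : (h z).re = (z - c) • dslope (fun w => (h w).re) c z)
  · exact (by rw [sub_smul_dslope, h0]; simp : (h z).imI = (z - c) • dslope (fun w => (h w).imI) c z)
  · exact (by rw [sub_smul_dslope, h0]; simp : (h z).imJ = (z - c) • dslope (fun w => (h w).imJ) c z)
  · exact (by rw [sub_smul_dslope, h0]; simp : (h z).imK = (z - c) • dslope (fun w => (h w).imK) c z)

theorem conjCoeff_add (v w : ℍ[ℂ]) : conjCoeff (v + w) = conjCoeff v + conjCoeff w := by
  ext <;> simp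

theorem conjCoeff_conjCoeff (w : ℍ[ℂ]) : conjCoeff (conjCoeff w) = w := by
  ext <;> simp

theorem conjCoeff_zero : conjCoeff 0 = 0 := by
  ext <;> simp

/-- A holomorphic quotient of a stem function by a real polynomial can be made symmetric. -/
theorem IsStem.exists_symm_quotient {h k : ℂ → ℍ[ℂ]} (hh : IsStem h) (hk : IsHol k) {P : ℂ → ℂ}
    (hP : ∀ z, P (conj z) = conj (P z)) (hq : ∀ z ∈ Metric.ball (0 : ℂ) 1, h z = P z • k z) :
    ∃ k', IsStem k' ∧ ∀ z ∈ Metric.ball (0 : ℂ) 1, h z = P z • k' z := by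
  refine ⟨fun z => (1 / 2 : ℂ) • (k z + conjCoeff (k (conj z))),
    { re := ?_, imI := ?_, imJ := ?_, imK := ?_, symm := fun z _ => ?_ }, fun z hz => ?_⟩
  · simpa [mul_add] using (hk.re.add (differentiableOn_conj_conj hk.re)).const_mul (1 / 2 : ℂ)
  · simpa [mul_add] using (hk.imI.add (differentiableOn_conj_conj hk.imI)).const_mul (1 / 2 : ℂ)
  · simpa [mul_add] using (hk.imJ.add (differentiableOn_conj_conj hk.imJ)).const_mul (1 / 2 : ℂ)
  · simpa [mul_add] using (hk.imK.add (differentiableOn_conj_conj hk.imK)).const_mul (1 / 2 : ℂ)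
  · rw [Complex.conj_conj, conjCoeff_smul, conjCoeff_add, conjCoeff_conjCoeff, add_comm, map_div₀, map_one, map_ofNat]
  -- The reflected `k` is also a quotient of `h` by `P`, so the average of the two is a symmetric
  -- quotient.
  · have h2 : h z = P z • conjCoeff (k (conj z)) := by
      have := congrArg conjCoeff (hh.symm z hz)
      rw [conjCoeff_conjCoeff, hq _ (conj_mem_ball hz), conjCoeff_smul, hP, Complex.conj_conj] at this
      exact this.symm
    rw [smul_comm, smul_add, ← hq z hz, ← h2, ← two_smul ℂ, smul_smul]
    norm_num

theorem IsStem.exists_eq_sub_ofReal_smul {h : ℂ → ℍ[ℂ]} (hh : IsStem h) {x : ℝ}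
    (hx : (x : ℂ) ∈ Metric.ball (0 : ℂ) 1) (h0 : h x = 0) :
    ∃ k, IsStem k ∧ ∀ z ∈ Metric.ball (0 : ℂ) 1, h z = (z - x) • k z := by
  obtain ⟨k, hk, e⟩ := hh.exists_eq_sub_smul hx h0
  exact hh.exists_symm_quotient hk (P := fun z => z - x) (by simp) fun z _ => e z

theorem quadratic_eq_mul (x y : ℝ) (z : ℂ) :
    (z - x) ^ 2 + (y : ℂ) ^ 2 = (z - ⟨x, y⟩) * (z - conj ⟨x, y⟩) := by
  have h1 : (⟨x, y⟩ : ℂ) = x + y * Complex.I := Complex.mk_eq_add_mul_I x y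
  rw [h1]
  simp
  linear_combination (y : ℂ) ^ 2 * Complex.I_sq

/-- By symmetry `h` also vanishes at the conjugate point, distinct because `y > 0`, so both linear
factors divide it. -/
theorem IsStem.exists_eq_quadratic_smul {h : ℂ → ℍ[ℂ]} (hh : IsStem h) {x y : ℝ} (hy : 0 < y)
    (hz : (⟨x, y⟩ : ℂ) ∈ Metric.ball (0 : ℂ) 1) (h0 : h ⟨x, y⟩ = 0) :
    ∃ k, IsStem k ∧ ∀ z ∈ Metric.ball (0 : ℂ) 1, h z = ((z - x) ^ 2 + (y : ℂ) ^ 2) • k z := by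
  obtain ⟨k, hk, e⟩ := hh.exists_eq_sub_smul hz h0
  have hne : conj (⟨x, y⟩ : ℂ) - ⟨x, y⟩ ≠ 0 := fun h => by
    have := congrArg Complex.im h
    simp at this
    linarith
  have h0' : k (conj ⟨x, y⟩) = 0 := by
    have := e (conj ⟨x, y⟩)
    rw [hh.symm _ hz, h0, conjCoeff_zero] at this
    exact (smul_eq_zero.1 this.symm).resolve_left hne
  obtain ⟨k', hk', e'⟩ := hk.exists_eq_sub_smul (conj_mem_ball hz) h0'
  refine hh.exists_symm_quotient hk' (P := fun z => (z - x) ^ 2 + (y : ℂ) ^ 2) (by simp) fun z _ => ?_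
  rw [e, e', smul_smul, quadratic_eq_mul]

theorem quadratic_ne_zero {x y : ℝ} (hy : 0 < y) (t : ℝ) : ((t : ℂ) - x) ^ 2 + (y : ℂ) ^ 2 ≠ 0 := by
  have : (t - x) ^ 2 + y ^ 2 ≠ 0 := by positivity
  exact_mod_cast this

/-- The quadratic has no real zero, so it cancels on the real axis and the identity theorem does the
rest. -/
theorem IsHol.eqOn_of_quadratic_smul {g h : ℂ → ℍ[ℂ]} (hg : IsHol g) (hh : IsHol h) {x y : ℝ}
    (hy : 0 < y) (e : ∀ z ∈ Metric.ball (0 : ℂ) 1,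
      ((z - x) ^ 2 + (y : ℂ) ^ 2) • g z = ((z - x) ^ 2 + (y : ℂ) ^ 2) • h z) :
    ∀ z ∈ Metric.ball (0 : ℂ) 1, g z = h z := by
  have hr : ∀ t : ℝ, (t : ℂ) ∈ Metric.ball (0 : ℂ) 1 → g t = h t := fun t ht =>
    smul_right_injective _ (quadratic_ne_zero hy t) (e t ht)
  intro z hz
  ext1
  · exact sub_eq_zero.1 (eqOn_zero_of_forall_real (hg.re.sub hh.re) (fun t ht => by simp [hr t ht]) z hz)
  · exact sub_eq_zero.1 (eqOn_zero_of_forall_real (hg.imI.sub hh.imI) (fun t ht => by simp [hr t ht]) z hz)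
  · exact sub_eq_zero.1 (eqOn_zero_of_forall_real (hg.imJ.sub hh.imJ) (fun t ht => by simp [hr t ht]) z hz)
  · exact sub_eq_zero.1 (eqOn_zero_of_forall_real (hg.imK.sub hh.imK) (fun t ht => by simp [hr t ht]) z hz)

theorem star_complexify (p : ℍ[ℝ]) : star (complexify p) = complexify (star p) := by
  ext <;> simp

theorem normSq_coe_sub_complexify {p : ℍ[ℝ]} {x y : ℝ} (hp : p ∈ sphereAt x y) (z : ℂ) :
    Quaternion.normSq ((z : ℍ[ℂ]) - complexify p) = (z - x) ^ 2 + (y : ℂ) ^ 2 := by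
  obtain ⟨I, hI, rfl⟩ := hp
  obtain ⟨h0, h1⟩ := mem_imagUnits_iff.1 hI
  have h2 : (I.imI : ℂ) ^ 2 + (I.imJ : ℂ) ^ 2 + (I.imK : ℂ) ^ 2 = 1 := by exact_mod_cast h1
  rw [Quaternion.normSq_def']
  simp [h0]
  linear_combination (y : ℂ) ^ 2 * h2

theorem coe_sub_complexify_mul_star {p : ℍ[ℝ]} {x y : ℝ} (hp : p ∈ sphereAt x y) (z : ℂ) :
    ((z : ℍ[ℂ]) - complexify p) * ((z : ℍ[ℂ]) - complexify (star p)) =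
      (((z - x) ^ 2 + (y : ℂ) ^ 2 : ℂ) : ℍ[ℂ]) := by
  rw [← normSq_coe_sub_complexify hp, ← Quaternion.self_mul_star, star_sub, star_complexify,
    Quaternion.star_coe]

/-- A zero of the induced function on a sphere splits off a linear factor. -/
theorem IsStem.exists_eq_linear_mul {h : ℂ → ℍ[ℂ]} (hh : IsStem h) {x y : ℝ} (hy : 0 < y)
    (hz : (⟨x, y⟩ : ℂ) ∈ Metric.ball (0 : ℂ) 1) {I : ℍ[ℝ]} (hI : I ∈ imagUnits)
    (h0 : evalAt I (h ⟨x, y⟩) = 0) :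
    ∃ k, IsStem k ∧ ∀ z ∈ Metric.ball (0 : ℂ) 1,
      h z = ((z : ℍ[ℂ]) - complexify (sliceMap I ⟨x, y⟩)) * k z := by
  -- With `Q` the quadratic and `p` the zero, `(z - p̄) h` vanishes at `x + i y`, hence equals `Q
  -- k`. Then `Q h = (z - p)(z - p̄) h = Q (z - p) k`, and `Q` cancels.
  obtain ⟨k, hk, e⟩ := ((isStem_coe_sub_complexify (star (sliceMap I ⟨x, y⟩))).mul
    hh).exists_eq_quadratic_smul hy hz (complexify_star_sub_mul hI h0 _)
  refine ⟨k, hk, hh.toIsHol.eqOn_of_quadratic_smul (x := x)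
    ((isStem_coe_sub_complexify (sliceMap I ⟨x, y⟩)).mul hk).toIsHol hy fun z hz => ?_⟩
  rw [← Algebra.mul_smul_comm, ← e z hz, ← mul_assoc,
    coe_sub_complexify_mul_star (mem_sphereAt_iff.2 ⟨I, hI, rfl⟩), Quaternion.coe_mul_eq_smul]

theorem analyticOrderAt_quadratic {x y : ℝ} (hy : 0 < y) :
    analyticOrderAt (fun z : ℂ => (z - x) ^ 2 + (y : ℂ) ^ 2) ⟨x, y⟩ = 1 := by
  have ha : AnalyticAt ℂ (fun z : ℂ => (z - x) ^ 2 + (y : ℂ) ^ 2) ⟨x, y⟩ := by fun_prop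
  refine (ha.analyticOrderAt_eq_natCast (n := 1)).2
    ⟨fun z => z - conj ⟨x, y⟩, by fun_prop, fun h => ?_, .of_forall fun z => ?_⟩
  · have := congrArg Complex.im h
    simp at this
    linarith
  · rw [quadratic_eq_mul, pow_one, smul_eq_mul]

/-- `N(z - p)` is the quadratic of the sphere, which has a simple zero at `x + i y`. A scalar factor
is squared by `N`, hence the 2 in the next two lemmas. -/
theorem stemOrder_linear_mul {h k : ℂ → ℍ[ℂ]} (hk : IsStem k) {x y : ℝ} (hy : 0 < y)
    (hz : (⟨x, y⟩ : ℂ) ∈ Metric.ball (0 : ℂ) 1) {p : ℍ[ℝ]} (hp : p ∈ sphereAt x y)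
    (e : ∀ z ∈ Metric.ball (0 : ℂ) 1, h z = ((z : ℍ[ℂ]) - complexify p) * k z) :
    stemOrder h ⟨x, y⟩ = 1 + stemOrder k ⟨x, y⟩ := by
  have ha : AnalyticAt ℂ (fun z : ℂ => (z - x) ^ 2 + (y : ℂ) ^ 2) ⟨x, y⟩ := by fun_prop
  have hev : (fun w => Quaternion.normSq (h w)) =ᶠ[𝓝 ⟨x, y⟩]
      (fun z : ℂ => (z - x) ^ 2 + (y : ℂ) ^ 2) * fun w => Quaternion.normSq (k w) :=
    Filter.eventuallyEq_of_mem (Metric.isOpen_ball.mem_nhds hz) fun z hz => by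
      simp only [e z hz, map_mul, normSq_coe_sub_complexify hp, Pi.mul_apply]
  rw [stemOrder, analyticOrderAt_congr hev, analyticOrderAt_mul ha (hk.analyticAt_normSq hz),
    analyticOrderAt_quadratic hy]

theorem stemOrder_quadratic_smul {h k : ℂ → ℍ[ℂ]} (hk : IsStem k) {x y : ℝ} (hy : 0 < y)
    (hz : (⟨x, y⟩ : ℂ) ∈ Metric.ball (0 : ℂ) 1)
    (e : ∀ z ∈ Metric.ball (0 : ℂ) 1, h z = ((z - x) ^ 2 + (y : ℂ) ^ 2) • k z) :
    stemOrder h ⟨x, y⟩ = 2 + stemOrder k ⟨x, y⟩ := by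
  have ha : AnalyticAt ℂ (fun z : ℂ => (z - x) ^ 2 + (y : ℂ) ^ 2) ⟨x, y⟩ := by fun_prop
  have hev : (fun w => Quaternion.normSq (h w)) =ᶠ[𝓝 ⟨x, y⟩]
      (fun z : ℂ => (z - x) ^ 2 + (y : ℂ) ^ 2) ^ 2 * fun w => Quaternion.normSq (k w) :=
    Filter.eventuallyEq_of_mem (Metric.isOpen_ball.mem_nhds hz) fun z hz => by
      simp only [e z hz, Quaternion.normSq_smul, Pi.mul_apply, Pi.pow_apply]
  rw [stemOrder, analyticOrderAt_congr hev, analyticOrderAt_mul (ha.pow 2)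
    (hk.analyticAt_normSq hz), analyticOrderAt_pow ha, analyticOrderAt_quadratic hy]
  simp

theorem stemOrder_sub_ofReal_smul {h k : ℂ → ℍ[ℂ]} (hk : IsStem k) {x : ℝ}
    (hz : (x : ℂ) ∈ Metric.ball (0 : ℂ) 1)
    (e : ∀ z ∈ Metric.ball (0 : ℂ) 1, h z = (z - x) • k z) :
    stemOrder h x = 2 + stemOrder k x := by
  have ha : AnalyticAt ℂ (fun z : ℂ => z - (x : ℂ)) x := by fun_prop
  have h1 : analyticOrderAt (fun z : ℂ => z - (x : ℂ)) x = 1 :=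
    (ha.analyticOrderAt_eq_natCast (n := 1)).2 ⟨fun _ => 1, by fun_prop, one_ne_zero,
      .of_forall fun z => by simp⟩
  have hev : (fun w => Quaternion.normSq (h w)) =ᶠ[𝓝 (x : ℂ)]
      (fun z : ℂ => z - (x : ℂ)) ^ 2 * fun w => Quaternion.normSq (k w) :=
    Filter.eventuallyEq_of_mem (Metric.isOpen_ball.mem_nhds hz) fun z hz => by
      simp only [e z hz, Quaternion.normSq_smul, Pi.mul_apply, Pi.pow_apply]
  rw [stemOrder, analyticOrderAt_congr hev, analyticOrderAt_mul (ha.pow 2)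
    (hk.analyticAt_normSq hz), analyticOrderAt_pow ha, h1]
  simp

/-! ### Factorization at spheres and at real points -/

/-- The stem function `(z - p₁) ⋯ (z - pₙ)`. -/
noncomputable def linearProd (ps : List ℍ[ℝ]) (z : ℂ) : ℍ[ℂ] :=
  (ps.map fun p => (z : ℍ[ℂ]) - complexify p).prod

theorem linearProd_cons (p : ℍ[ℝ]) (ps : List ℍ[ℝ]) (z : ℂ) :
    linearProd (p :: ps) z = ((z : ℍ[ℂ]) - complexify p) * linearProd ps z := by
  simp [linearProd]

theorem isStem_linearProd_mul (ps : List ℍ[ℝ]) {g : ℂ → ℍ[ℂ]} (hg : IsStem g) :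
    IsStem (fun z => linearProd ps z * g z) := by
  induction ps with
  | nil => simpa [linearProd] using hg
  | cons p ps ih =>
    simp only [linearProd_cons, mul_assoc]
    exact (isStem_coe_sub_complexify p).mul ih

theorem induces_linearStarProd (ps : List ℍ[ℝ]) {g : ℂ → ℍ[ℂ]} {G : ℍ[ℝ] → ℍ[ℝ]} (hg : IsStem g)
    (hG : Induces g G) : Induces (fun z => linearProd ps z * g z) (linearStarProd ps G) := by
  induction ps with
  | nil => simpa [linearProd, linearStarProd] using hG
  | cons p ps ih =>
    simp only [linearProd_cons, mul_assoc]
    exact Induces.starMul (isStem_coe_sub_complexify p) (isStem_linearProd_mul ps hg)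
      (induces_sub p) ih

/-- Splitting off all linear factors at a sphere on which the stem function does not vanish. -/
theorem IsStem.exists_linearProd {x y : ℝ} (hy : 0 < y)
    (hz : (⟨x, y⟩ : ℂ) ∈ Metric.ball (0 : ℂ) 1) (n : ℕ) :
    ∀ {h : ℂ → ℍ[ℂ]}, IsStem h → h ⟨x, y⟩ ≠ 0 → stemOrder h ⟨x, y⟩ = n →
    ∃ (ps : List ℍ[ℝ]) (g : ℂ → ℍ[ℂ]), IsStem g ∧ ps.length = n ∧ (∀ p ∈ ps, p ∈ sphereAt x y) ∧
      ps.IsChain (fun p p' => p ≠ star p') ∧ Quaternion.normSq (g ⟨x, y⟩) ≠ 0 ∧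
      ∀ z ∈ Metric.ball (0 : ℂ) 1, h z = linearProd ps z * g z := by
  induction n with
  | zero =>
    intro h hh _ ho
    refine ⟨[], h, hh, rfl, by simp, .nil, ?_, by simp [linearProd]⟩
    exact (hh.analyticAt_normSq hz).analyticOrderAt_eq_zero.1 (by simpa using ho)
  | succ n ih =>
    intro h hh hne ho
    have h0 : Quaternion.normSq (h ⟨x, y⟩) = 0 := by
      by_contra hne
      have := (hh.analyticAt_normSq hz).analyticOrderAt_eq_zero.2 hne
      rw [stemOrder, this] at ho
      exact absurd ho.symm (by exact_mod_cast n.succ_ne_zero)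
    obtain ⟨I, hI, hev⟩ := exists_evalAt_eq_zero h0
    obtain ⟨k, hk, e⟩ := hh.exists_eq_linear_mul hy hz hI hev
    set p := sliceMap I ⟨x, y⟩ with hpdef
    have hp : p ∈ sphereAt x y := mem_sphereAt_iff.2 ⟨I, hI, rfl⟩
    have hk0 : k ⟨x, y⟩ ≠ 0 := fun hk0 => hne (by rw [e _ hz, hk0, mul_zero])
    have hko : stemOrder k ⟨x, y⟩ = n := by
      rw [stemOrder_linear_mul hk hy hz hp e, Nat.cast_succ, add_comm] at ho
      exact (ENat.add_left_injective_of_ne_top ENat.one_ne_top) ho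
    obtain ⟨ps, g, hg, hl, hps, hc, hg0, e'⟩ := ih hk hk0 hko
    refine ⟨p :: ps, g, hg, by simp [hl], by simpa using ⟨hp, hps⟩, ?_, hg0, fun z hz => by
      rw [e z hz, e' z hz, linearProd_cons, mul_assoc]⟩
    cases ps with
    | nil => exact .singleton p
    | cons p' ps =>
      -- Adjacent conjugate factors would multiply to the quadratic of the sphere, forcing `h` to
      -- vanish at `x + i y`.
      refine .cons_cons (fun hpp => hne ?_) hc
      rw [e _ hz, e' _ hz, linearProd_cons, hpp, mul_assoc, ← mul_assoc, ← mul_assoc]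
      have := coe_sub_complexify_mul_star (hpp ▸ hp) (⟨x, y⟩ : ℂ)
      rw [star_star] at this
      rw [this, quadratic_eq_mul]
      simp

/-- Splitting off all spherical factors at a sphere. -/
theorem IsStem.exists_quadratic_pow {x y : ℝ} (hy : 0 < y)
    (hz : (⟨x, y⟩ : ℂ) ∈ Metric.ball (0 : ℂ) 1) (n : ℕ) :
    ∀ {h : ℂ → ℍ[ℂ]}, IsStem h → stemOrder h ⟨x, y⟩ = n →
    ∃ (m : ℕ) (k : ℂ → ℍ[ℂ]), IsStem k ∧ k ⟨x, y⟩ ≠ 0 ∧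
      stemOrder h ⟨x, y⟩ = 2 * m + stemOrder k ⟨x, y⟩ ∧
      ∀ z ∈ Metric.ball (0 : ℂ) 1, h z = (((z - x) ^ 2 + (y : ℂ) ^ 2) ^ m) • k z := by
  induction n using Nat.strong_induction_on with
  | _ n ih =>
    intro h hh ho
    by_cases h0 : h ⟨x, y⟩ = 0
    · obtain ⟨k, hk, e⟩ := hh.exists_eq_quadratic_smul hy hz h0
      have hko := stemOrder_quadratic_smul hk hy hz e
      obtain ⟨l, hl⟩ : ∃ l : ℕ, stemOrder k ⟨x, y⟩ = l := by
        refine (ENat.ne_top_iff_exists.1 fun ht => ?_).imp fun _ => Eq.symm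
        rw [ht, ho] at hko
        exact absurd hko (by simp)
      have hln : l < n := by
        rw [hl, ho] at hko
        have : n = 2 + l := by exact_mod_cast hko
        omega
      obtain ⟨m, k', hk', hne, ho', e'⟩ := ih l hln hk hl
      refine ⟨m + 1, k', hk', hne, ?_, fun z hz => ?_⟩
      · rw [hko, ho']
        push_cast
        ring
      · rw [e z hz, e' z hz, smul_smul, pow_succ' _ m]
    · exact ⟨0, h, hh, h0, by simp, by simp⟩

theorem exists_hasSphereMultiplicities {f : ℍ[ℝ] → ℍ[ℝ]} {h : ℂ → ℍ[ℂ]} (hh : IsStem h)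
    (hf : Induces h f) {x y : ℝ} (hy : 0 < y) (hz : (⟨x, y⟩ : ℂ) ∈ Metric.ball (0 : ℂ) 1)
    (ht : stemOrder h ⟨x, y⟩ ≠ ⊤) :
    ∃ (m : ℕ) (ps : List ℍ[ℝ]), HasSphereMultiplicities f x y m ps ∧
      stemOrder h ⟨x, y⟩ = 2 * m + ps.length := by
  obtain ⟨n, hn⟩ := ENat.ne_top_iff_exists.1 ht
  obtain ⟨m, k, hk, hk0, ho, e⟩ := hh.exists_quadratic_pow hy hz n hn.symm
  obtain ⟨l, hl⟩ : ∃ l : ℕ, stemOrder k ⟨x, y⟩ = l := by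
    refine (ENat.ne_top_iff_exists.1 fun ht' => ht ?_).imp fun _ => Eq.symm
    rw [ho, ht', add_top]
  obtain ⟨ps, g, hg, hlen, hps, hc, hg0, e'⟩ := hk.exists_linearProd hy hz l hk0 hl
  refine ⟨m, ps, ⟨hps, hc, induced g, hg.induces_induced.sliceRegular hg.toIsHol, ?_, ?_⟩, ?_⟩
  · rintro _ ⟨I, hI, rfl⟩ h0
    refine hg0 (normSq_eq_zero_of_evalAt hI ?_)
    rw [← hg.induces_induced I hI _ hz]
    exact h0
  · intro q hq
    obtain ⟨I, hI, hqI⟩ := exists_sliceMap_eq q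
    rw [hqI] at hq ⊢
    have hzb := (sliceMap_mem_unitBall hI).1 hq
    rw [hf I hI _ hzb, induces_linearStarProd ps hg hg.induces_induced I hI _ hzb, e _ hzb,
      evalAt_smul hI, e' _ hzb, sliceMap_pow hI, sliceMap_add, sliceMap_pow hI, sliceMap_sub_ofReal,
      sliceMap_pow hI, sliceMap_ofReal]
  · rw [ho, hl, hlen]

theorem exists_hasRealMultiplicity {x : ℝ} (hx : (x : ℂ) ∈ Metric.ball (0 : ℂ) 1) (n : ℕ) :
    ∀ {f : ℍ[ℝ] → ℍ[ℝ]} {h : ℂ → ℍ[ℂ]}, IsStem h → Induces h f → stemOrder h x = n →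
    ∃ k : ℕ, HasRealMultiplicity f x k ∧ stemOrder h x = 2 * k := by
  induction n using Nat.strong_induction_on with
  | _ n ih =>
    intro f h hh hf ho
    by_cases h0 : h x = 0
    · obtain ⟨k, hk, e⟩ := hh.exists_eq_sub_ofReal_smul hx h0
      have hko := stemOrder_sub_ofReal_smul hk hx e
      obtain ⟨l, hl⟩ : ∃ l : ℕ, stemOrder k x = l := by
        refine (ENat.ne_top_iff_exists.1 fun ht => ?_).imp fun _ => Eq.symm
        rw [ht, ho] at hko
        exact absurd hko (by simp)
      have hln : l < n := by
        rw [hl, ho] at hko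
        have : n = 2 + l := by exact_mod_cast hko
        omega
      obtain ⟨j, ⟨g, hg, hg0, e'⟩, hj⟩ := ih l hln hk hk.induces_induced hl
      refine ⟨j + 1, ⟨g, hg, hg0, fun q hq => ?_⟩, ?_⟩
      · rw [pow_succ', mul_assoc, ← e' q hq]
        obtain ⟨I, hI, hqI⟩ := exists_sliceMap_eq q
        rw [hqI] at hq ⊢
        have hzb := (sliceMap_mem_unitBall hI).1 hq
        rw [hf I hI _ hzb, e _ hzb, evalAt_smul hI, sliceMap_sub_ofReal,
          hk.induces_induced I hI _ hzb]
      · rw [hko, hj]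
        push_cast
        ring
    -- At a real point `b = 0` and `N(h) = |a|²`, so `N(h)` vanishes only if `h` does.
    · have him := hh.imPart_eq_zero hx
      have hfx : f x = rePart (h x) := by
        rw [← sliceMap_ofReal unitI, hf _ unitI_mem_imagUnits _ hx, evalAt, him, mul_zero, add_zero]
      have hre : rePart (h x) ≠ 0 := fun hre =>
        h0 (ext_parts (by rw [hre]; ext <;> simp) (by rw [him]; ext <;> simp))
      refine ⟨0, ⟨f, hf.sliceRegular hh.toIsHol, by rwa [hfx], by simp⟩, ?_⟩
      simp only [Nat.cast_zero, mul_zero]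
      refine (hh.analyticAt_normSq hx).analyticOrderAt_eq_zero.2 fun hN => hre ?_
      rw [normSq_eq_parts, him] at hN
      simpa using congrArg Complex.re hN

/-! ### Jensen's formula and the Blaschke condition in the disc -/

theorem divisor_eq_analyticOrderNatAt {u : ℂ → ℂ} {U : Set ℂ} (hu : AnalyticOnNhd ℂ u U) {z : ℂ}
    (hz : z ∈ U) : MeromorphicOn.divisor u U z = (analyticOrderNatAt u z : ℤ) := by
  rw [MeromorphicOn.AnalyticOnNhd.divisor_apply hu hz, analyticOrderNatAt]
  cases analyticOrderAt u z <;> rfl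

/-- Jensen's formula as a bound for the zeros in a disc. -/
theorem sum_order_mul_le_circleAverage {u : ℂ → ℂ} {r : ℝ} (hr : 0 < r)
    (hu : AnalyticOnNhd ℂ u (Metric.closedBall 0 |r|)) (S : Finset ℂ)
    (hS : ∀ z ∈ S, ‖z‖ < r) (hS0 : (0 : ℂ) ∉ S) :
    ∑ z ∈ S, (analyticOrderNatAt u z : ℝ) * (1 - ‖z‖ * r⁻¹) + analyticOrderNatAt u 0 * Real.log r
      + Real.log ‖meromorphicTrailingCoeffAt u 0‖ ≤
      Real.circleAverage (fun z => Real.log ‖u z‖) 0 r := by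
  rw [MeromorphicOn.circleAverage_log_norm hr.ne' hu.meromorphicOn,
    divisor_eq_analyticOrderNatAt hu (by simp)]
  have habs := abs_of_pos hr
  have hfin := (MeromorphicOn.divisor u (Metric.closedBall 0 |r|)).finiteSupport
    (isCompact_closedBall _ _)
  have hnn : ∀ z, 0 ≤ (MeromorphicOn.divisor u (Metric.closedBall 0 |r|) z : ℝ)
      * Real.log (r * ‖0 - z‖⁻¹) := fun z => by
    by_cases hz : z ∈ Metric.closedBall (0 : ℂ) |r|
    · refine mul_nonneg (by exact_mod_cast MeromorphicOn.AnalyticOnNhd.divisor_nonneg hu z) ?_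
      -- At `z = 0` the term is zero by the conventions `0⁻¹ = 0` and `log 0 = 0`; Jensen's formula
      -- treats the origin separately.
      rcases eq_or_ne z 0 with rfl | h0
      · simp
      · refine Real.log_nonneg ?_
        have hz' : ‖z‖ ≤ r := by simpa [habs] using hz
        rw [zero_sub, norm_neg, ← div_eq_mul_inv, one_le_div (norm_pos_iff.2 h0)]
        exact hz'
    · simp [hz]
  have hsum : ∑ z ∈ S, (analyticOrderNatAt u z : ℝ) * (1 - ‖z‖ * r⁻¹) ≤
      ∑ᶠ z, (MeromorphicOn.divisor u (Metric.closedBall 0 |r|) z : ℝ)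
        * Real.log (r * ‖0 - z‖⁻¹) := by
    classical
    rw [finsum_eq_sum_of_support_subset (s := hfin.toFinset ∪ S)]
    · refine le_trans (Finset.sum_le_sum fun z hz => ?_)
        (Finset.sum_le_sum_of_subset_of_nonneg Finset.subset_union_right fun z _ _ => hnn z)
      have h0 : z ≠ 0 := fun h => hS0 (h ▸ hz)
      have hzb : z ∈ Metric.closedBall (0 : ℂ) |r| := by simpa [habs] using (hS z hz).le
      rw [divisor_eq_analyticOrderNatAt hu hzb, Int.cast_natCast, zero_sub, norm_neg]
      refine mul_le_mul_of_nonneg_left ?_ (Nat.cast_nonneg _)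
      -- This is `log t ≥ 1 - 1/t` at `t = r / |z|`.
      have := Real.one_sub_inv_le_log_of_pos (mul_pos hr (inv_pos.2 (norm_pos_iff.2 h0)))
      rwa [mul_inv, inv_inv, mul_comm r⁻¹] at this
    · intro z hz
      simp only [Function.mem_support] at hz
      simp only [Finset.coe_union, Set.Finite.coe_toFinset, Set.mem_union, Function.mem_support]
      exact Or.inl fun h => hz (by simp [h])
  simp only [Int.cast_natCast]
  linarith

/-- Bounded logarithmic means imply the Blaschke condition for the zeros in the disc. -/
theorem exists_sum_order_mul_le {u : ℂ → ℂ} (hu : AnalyticOnNhd ℂ u (Metric.ball 0 1)) {C : ℝ}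
    (hC : ∀ᶠ r in 𝓝[<] (1 : ℝ), Real.circleAverage (fun z => Real.log ‖u z‖) 0 r ≤ C) :
    ∃ K : ℝ, ∀ S : Finset ℂ, (∀ z ∈ S, z ∈ Metric.ball (0 : ℂ) 1) →
      ∑ z ∈ S, (analyticOrderNatAt u z : ℝ) * (1 - ‖z‖) ≤ K := by
  classical
  -- The constant comes from letting `r → 1` in the Jensen bound, where `log r → 0`. The order at
  -- `0` is added because the origin has weight 1 in the sum but is left out of that bound's sum.
  refine ⟨C - Real.log ‖meromorphicTrailingCoeffAt u 0‖ + analyticOrderNatAt u 0, fun S hS => ?_⟩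
  have hlim : Tendsto (fun r : ℝ => ∑ z ∈ S.erase 0, (analyticOrderNatAt u z : ℝ) * (1 - ‖z‖ * r⁻¹)
      + analyticOrderNatAt u 0 * Real.log r + Real.log ‖meromorphicTrailingCoeffAt u 0‖) (𝓝[<] 1)
      (𝓝 (∑ z ∈ S.erase 0, (analyticOrderNatAt u z : ℝ) * (1 - ‖z‖ * 1⁻¹)
      + analyticOrderNatAt u 0 * Real.log 1 + Real.log ‖meromorphicTrailingCoeffAt u 0‖)) := by
    have hinv : Tendsto (fun r : ℝ => r⁻¹) (𝓝[<] 1) (𝓝 1⁻¹) :=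
      (tendsto_inv₀ one_ne_zero).mono_left nhdsWithin_le_nhds
    have hlog : Tendsto Real.log (𝓝[<] 1) (𝓝 (Real.log 1)) :=
      (Real.continuousAt_log one_ne_zero).tendsto.mono_left nhdsWithin_le_nhds
    exact ((tendsto_finsetSum _ fun z _ =>
      ((hinv.const_mul _).const_sub 1).const_mul _).add (hlog.const_mul _)).add_const _
  have hpos : ∀ᶠ r in 𝓝[<] (1 : ℝ), 0 < r :=
    nhdsWithin_le_nhds (lt_mem_nhds one_pos)
  have hlt : ∀ᶠ r in 𝓝[<] (1 : ℝ), ∀ z ∈ S, ‖z‖ < r :=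
    (Finset.eventually_all S).2 fun z hz =>
      nhdsWithin_le_nhds (lt_mem_nhds (by simpa using hS z hz))
  have hle := le_of_tendsto hlim (b := C) (by
    filter_upwards [hC, hpos, hlt, self_mem_nhdsWithin] with r h1 h2 h3 h4
    refine (sum_order_mul_le_circleAverage h2 (hu.mono ?_) (S.erase 0)
      (fun z hz => h3 z (Finset.mem_of_mem_erase hz)) (Finset.notMem_erase 0 S)).trans h1
    exact Metric.closedBall_subset_ball (by rwa [abs_of_pos h2]))
  simp only [inv_one, mul_one, Real.log_one, mul_zero, add_zero] at hle
  by_cases h0 : (0 : ℂ) ∈ S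
  · rw [← Finset.add_sum_erase S _ h0]
    simp only [norm_zero, sub_zero, mul_one]
    linarith
  · rw [Finset.erase_eq_of_notMem h0] at hle
    have : (0 : ℝ) ≤ analyticOrderNatAt u 0 := Nat.cast_nonneg _
    linarith

/-! ### Logarithmic means of the norm form of a Hardy function -/

theorem log_le_of_le_max_sq {N a b P : ℝ} (hP : 0 < P) (ha : 0 ≤ a) (hb : 0 ≤ b) (hN : 0 ≤ N)
    (h : N ≤ max a b ^ 2) : Real.log N ≤ 2 / P * (a ^ P + b ^ P) := by
  have haP := Real.rpow_nonneg ha P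
  have hbP := Real.rpow_nonneg hb P
  rcases hN.eq_or_lt with rfl | hN
  · rw [Real.log_zero]
    positivity
  · have h1 : Real.log N ≤ 2 * Real.log (max a b) := by
      have := Real.log_le_log hN h
      rwa [Real.log_pow] at this
    -- `log t ≤ t ^ P / P` holds for every `P > 0`, so small exponents need no separate treatment.
    have h2 := Real.log_le_rpow_div (le_max_of_le_left ha : 0 ≤ max a b) hP
    have h3 : max a b ^ P ≤ a ^ P + b ^ P := by
      rcases max_cases a b with ⟨e, -⟩ | ⟨e, -⟩ <;> rw [e] <;> linarith
    calc Real.log N ≤ 2 * (max a b ^ P / P) := h1.trans (by linarith)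
      _ ≤ 2 * ((a ^ P + b ^ P) / P) := by gcongr
      _ = _ := by ring

theorem SliceRegular.circleIntegrable_rpow {f : ℍ[ℝ] → ℍ[ℝ]} (hf : SliceRegular f) {I : ℍ[ℝ]}
    (hI : I ∈ imagUnits) {P r : ℝ} (hP : 0 < P) (hr0 : 0 ≤ r) (hr : r < 1) :
    CircleIntegrable (fun z => ‖f (sliceMap I z)‖ ^ P) 0 r := by
  refine ContinuousOn.circleIntegrable hr0 ?_
  have h1 : ContinuousOn (fun z => f (sliceMap I z)) (Metric.sphere 0 r) :=
    (hf I hI).1.continuousOn.mono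
      (Metric.sphere_subset_closedBall.trans (Metric.closedBall_subset_ball hr))
  exact h1.norm.rpow_const fun _ _ => Or.inr hP.le

theorem ofReal_circleAverage_rpow {f : ℍ[ℝ] → ℍ[ℝ]} (hf : SliceRegular f) {I : ℍ[ℝ]}
    (hI : I ∈ imagUnits) {P r : ℝ} (hP : 0 < P) (hr0 : 0 ≤ r) (hr : r < 1) :
    ENNReal.ofReal (Real.circleAverage (fun z => ‖f (sliceMap I z)‖ ^ P) 0 r)
      = integralMean f P I r ^ P := by
  have hint := hf.circleIntegrable_rpow hI hP hr0 hr
  rw [integralMean, ← ENNReal.rpow_mul, one_div_mul_cancel hP.ne', ENNReal.rpow_one,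
    Real.circleAverage, smul_eq_mul, ENNReal.ofReal_mul (by positivity), one_div,
    intervalIntegral.integral_of_le Real.two_pi_pos.le,
    ofReal_integral_eq_lintegral_ofReal
      ((intervalIntegrable_iff_integrableOn_Ioc_of_le Real.two_pi_pos.le).1 hint)
      (.of_forall fun θ => Real.rpow_nonneg (norm_nonneg _) _)]
  congr 1
  refine lintegral_congr fun θ => ?_
  rw [← ENNReal.ofReal_rpow_of_nonneg (norm_nonneg _) hP.le, ofReal_norm]

theorem MemHardy.exists_circleAverage_rpow_le {f : ℍ[ℝ] → ℍ[ℝ]} {p : ℝ≥0∞} (hp : 0 < p)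
    (hp' : p ≠ ∞) (hf : MemHardy f p) {I : ℍ[ℝ]} (hI : I ∈ imagUnits) :
    ∃ B : ℝ, ∀ᶠ r in 𝓝[<] (1 : ℝ),
      Real.circleAverage (fun z => ‖f (sliceMap I z)‖ ^ p.toReal) 0 r ≤ B := by
  obtain ⟨hreg, hn⟩ := hf
  have hP : 0 < p.toReal := ENNReal.toReal_pos hp.ne' hp'
  rw [hardyNorm, if_neg hp'] at hn
  have hlim := (le_iSup₂ (f := fun I (_ : I ∈ imagUnits) =>
    limsup (fun r : ℝ => integralMean f p.toReal I r) (𝓝[<] 1)) I hI).trans_lt hn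
  obtain ⟨B, hB1, hB2⟩ := exists_between hlim
  have hBt : B ^ p.toReal ≠ ∞ := ENNReal.rpow_ne_top_of_nonneg hP.le hB2.ne
  refine ⟨(B ^ p.toReal).toReal, ?_⟩
  have hpos : ∀ᶠ r in 𝓝[<] (1 : ℝ), 0 < r := nhdsWithin_le_nhds (lt_mem_nhds one_pos)
  filter_upwards [eventually_lt_of_limsup_lt hB1, hpos, self_mem_nhdsWithin] with r h1 h2 h3
  rw [← ENNReal.ofReal_le_iff_le_toReal hBt, ofReal_circleAverage_rpow hreg hI hP h2.le h3]
  exact ENNReal.rpow_le_rpow h1.le hP.le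

/-- One pair of opposite units, `±unitI`, suffices: it controls both parts of `h` on the whole disc.
-/
theorem MemHardy.exists_circleAverage_log_le {f : ℍ[ℝ] → ℍ[ℝ]} {p : ℝ≥0∞} (hp : 0 < p)
    (hf : MemHardy f p) {h : ℂ → ℍ[ℂ]} (hh : IsStem h) (hfh : Induces h f) :
    ∃ C : ℝ, ∀ᶠ r in 𝓝[<] (1 : ℝ),
      Real.circleAverage (fun z => Real.log ‖Quaternion.normSq (h z)‖) 0 r ≤ C := by
  have hI := unitI_mem_imagUnits
  have hI' := neg_mem_imagUnits hI
  have hpos : ∀ᶠ r in 𝓝[<] (1 : ℝ), 0 < r := nhdsWithin_le_nhds (lt_mem_nhds one_pos)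
  have hsph : ∀ r : ℝ, 0 < r → r < 1 → Metric.sphere (0 : ℂ) |r| ⊆ Metric.ball 0 1 := fun r h1 h2 =>
    Metric.sphere_subset_closedBall.trans (Metric.closedBall_subset_ball (by rwa [abs_of_pos h1]))
  have hint : ∀ r : ℝ, 0 < r → r < 1 →
      CircleIntegrable (fun z => Real.log ‖Quaternion.normSq (h z)‖) 0 r := fun r h1 h2 =>
    MeromorphicOn.circleIntegrable_log_norm fun z hz =>
      (hh.analyticAt_normSq (hsph r h1 h2 hz)).meromorphicAt
  have hmax : ∀ z ∈ Metric.ball (0 : ℂ) 1, ‖Quaternion.normSq (h z)‖ ≤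
      max ‖f (sliceMap unitI z)‖ ‖f (sliceMap (-unitI) z)‖ ^ 2 := fun z hz => by
    rw [hfh _ hI z hz, hfh _ hI' z hz]
    exact normSq_parts_le _ hI
  by_cases hp' : p = ∞
  · obtain ⟨-, hn⟩ := hf
    rw [hardyNorm, if_pos hp'] at hn
    set M := ⨆ q ∈ unitBall, ‖f q‖ₑ with hM
    have hfM : ∀ q ∈ unitBall, ‖f q‖ ≤ M.toReal := fun q hq => by
      have h1 : ‖f q‖ₑ ≤ M := le_iSup₂ (f := fun q (_ : q ∈ unitBall) => ‖f q‖ₑ) q hq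
      have := ENNReal.toReal_mono hn.ne h1
      rwa [toReal_enorm] at this
    refine ⟨M.toReal ^ 2, ?_⟩
    filter_upwards [hpos, self_mem_nhdsWithin] with r h1 h2
    refine Real.circleAverage_mono_on_of_le_circle (hint r h1 h2) fun z hz => ?_
    have hzb := hsph r h1 h2 hz
    refine (Real.log_le_self (norm_nonneg _)).trans ((hmax z hzb).trans ?_)
    refine pow_le_pow_left₀ (le_max_of_le_left (norm_nonneg _)) (max_le ?_ ?_) 2
    · exact hfM _ ((sliceMap_mem_unitBall hI).2 hzb)
    · exact hfM _ ((sliceMap_mem_unitBall hI').2 hzb)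
  · have hP : 0 < p.toReal := ENNReal.toReal_pos hp.ne' hp'
    obtain ⟨B, hB⟩ := hf.exists_circleAverage_rpow_le hp hp' hI
    obtain ⟨B', hB'⟩ := hf.exists_circleAverage_rpow_le hp hp' hI'
    refine ⟨2 / p.toReal * (B + B'), ?_⟩
    filter_upwards [hpos, self_mem_nhdsWithin, hB, hB'] with r h1 h2 h3 h4
    have hi := hf.1.circleIntegrable_rpow hI hP h1.le h2
    have hi' := hf.1.circleIntegrable_rpow hI' hP h1.le h2
    calc Real.circleAverage (fun z => Real.log ‖Quaternion.normSq (h z)‖) 0 r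
        ≤ Real.circleAverage ((2 / p.toReal) • ((fun z => ‖f (sliceMap unitI z)‖ ^ p.toReal)
            + fun z => ‖f (sliceMap (-unitI) z)‖ ^ p.toReal)) 0 r := by
          refine Real.circleAverage_mono (hint r h1 h2) ((hi.add hi').const_smul) fun z hz => ?_
          exact log_le_of_le_max_sq hP (norm_nonneg _) (norm_nonneg _) (norm_nonneg _)
            (hmax z (hsph r h1 h2 hz))
      _ = 2 / p.toReal * (Real.circleAverage (fun z => ‖f (sliceMap unitI z)‖ ^ p.toReal) 0 r
            + Real.circleAverage (fun z => ‖f (sliceMap (-unitI) z)‖ ^ p.toReal) 0 r) := by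
          rw [Real.circleAverage_smul, Real.circleAverage_add hi hi', smul_eq_mul]
      _ ≤ 2 / p.toReal * (B + B') := by gcongr

/-! ### Counting the zero sequence sphere by sphere -/

/-- The point `x + i y`, `y ≥ 0`, of the complex plane with `q ∈ x + y 𝕊`. -/
noncomputable def toUpperHalfPlane (q : ℍ[ℝ]) : ℂ := ⟨q.re, ‖q.im‖⟩

theorem norm_toUpperHalfPlane (q : ℍ[ℝ]) : ‖toUpperHalfPlane q‖ = ‖q‖ := by
  obtain ⟨I, hI, hq⟩ := exists_sliceMap_eq q
  have := norm_sliceMap hI (toUpperHalfPlane q)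
  rw [toUpperHalfPlane, ← hq] at this
  exact this.symm

theorem toUpperHalfPlane_mem_ball {q : ℍ[ℝ]} (hq : q ∈ unitBall) :
    toUpperHalfPlane q ∈ Metric.ball (0 : ℂ) 1 := by
  simpa [norm_toUpperHalfPlane, unitBall] using hq

/-- On the real axis `N(h) = |a|²`, so `N(h) ≡ 0` would force `h`, and then `f`, to vanish
identically. Connectedness of the disc gives finite order at every point. -/
theorem stemOrder_ne_top {f : ℍ[ℝ] → ℍ[ℝ]} {h : ℂ → ℍ[ℂ]} (hh : IsStem h) (hf : Induces h f)
    (hf0 : ∃ q ∈ unitBall, f q ≠ 0) {z : ℂ} (hz : z ∈ Metric.ball (0 : ℂ) 1) :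
    stemOrder h z ≠ ⊤ := by
  obtain ⟨w, hw, hne⟩ : ∃ w ∈ Metric.ball (0 : ℂ) 1, Quaternion.normSq (h w) ≠ 0 := by
    by_contra! H
    have hr : ∀ t : ℝ, (t : ℂ) ∈ Metric.ball (0 : ℂ) 1 → h t = 0 := fun t ht => by
      have him := hh.imPart_eq_zero ht
      have h0 := H t ht
      rw [normSq_eq_parts, him] at h0
      have hre : rePart (h t) = 0 := by simpa using congrArg Complex.re h0
      exact ext_parts (by rw [hre]; ext <;> simp) (by rw [him]; ext <;> simp)
    obtain ⟨q, hq, hfq⟩ := hf0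
    obtain ⟨I, hI, hqI⟩ := exists_sliceMap_eq q
    rw [hqI] at hq hfq
    have hzb := (sliceMap_mem_unitBall hI).1 hq
    have h0 : h ⟨q.re, ‖q.im‖⟩ = 0 := by
      ext1
      · exact eqOn_zero_of_forall_real hh.re (fun t ht => by simp [hr t ht]) _ hzb
      · exact eqOn_zero_of_forall_real hh.imI (fun t ht => by simp [hr t ht]) _ hzb
      · exact eqOn_zero_of_forall_real hh.imJ (fun t ht => by simp [hr t ht]) _ hzb
      · exact eqOn_zero_of_forall_real hh.imK (fun t ht => by simp [hr t ht]) _ hzb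
    refine hfq ?_
    rw [hf I hI _ hzb, h0]
    ext <;> simp [evalAt]
  refine (hh.differentiableOn_normSq.analyticOnNhd
    Metric.isOpen_ball).analyticOrderAt_ne_top_of_isPreconnected
    (convex_ball _ _).isPreconnected hw hz ?_
  rw [(hh.analyticAt_normSq hw).analyticOrderAt_eq_zero.2 hne]
  exact ENat.zero_ne_top

theorem sum_indicator_le {α : Type*} (T F : Finset α) (c : ℕ∞) :
    ∑ q ∈ T, Set.indicator (F : Set α) (fun _ => c) q ≤ F.card * c := by
  classical
  rw [Finset.sum_indicator_eq_sum_filter, Finset.sum_const, nsmul_eq_mul]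
  gcongr
  exact fun q hq => by simpa using (Finset.mem_filter.1 hq).2

/-- The number of terms of the zero sequence on a sphere is at most the vanishing order of the norm
form. -/
theorem card_filter_le_stemOrder {ι : Type*} {f : ℍ[ℝ] → ℍ[ℝ]} {h : ℂ → ℍ[ℂ]} (hh : IsStem h)
    (hf : Induces h f) {b : ι → ℍ[ℝ]} (hb : IsZeroSequence f b) (s : Finset ι) {z : ℂ}
    (hz : z ∈ Metric.ball (0 : ℂ) 1) (him : 0 ≤ z.im) (ht : stemOrder h z ≠ ⊤) [DecidableEq ℂ] :
    ((s.filter fun i => toUpperHalfPlane (b i) = z).card : ℕ∞) ≤ stemOrder h z := by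
  classical
  rcases him.eq_or_lt with h0 | h0
  · obtain ⟨x, rfl⟩ : ∃ x : ℝ, (x : ℂ) = z := ⟨z.re, Complex.ext (by simp) (by simp [h0])⟩
    obtain ⟨n, hn⟩ := ENat.ne_top_iff_exists.1 ht
    obtain ⟨k, hk, ho⟩ := exists_hasRealMultiplicity hz n hh hf hn.symm
    have hx : (x : ℍ[ℝ]) ∈ unitBall := by
      rw [← sliceMap_ofReal unitI]
      exact (sliceMap_mem_unitBall unitI_mem_imagUnits).2 hz
    have hcard := hb.real x k hx hk
    rw [ho, ← Set.encard_coe_eq_coe_finsetCard]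
    calc _ ≤ Set.encard {i | b i = (x : ℍ[ℝ])} := by
          refine Set.encard_le_encard fun i hi => ?_
          have hi' : toUpperHalfPlane (b i) = x := by simpa using (Finset.mem_filter.1 hi).2
          obtain ⟨I, -, hq⟩ := exists_sliceMap_eq (b i)
          rw [← toUpperHalfPlane, hi', sliceMap_ofReal] at hq
          exact hq
      _ = k := hcard
      _ ≤ 2 * k := by rw [two_mul]; exact le_self_add
  · obtain ⟨m, ps, hm, ho⟩ := exists_hasSphereMultiplicities hh hf h0 hz ht
    have hsub : sphereAt z.re z.im ⊆ unitBall := by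
      rintro _ ⟨I, hI, rfl⟩
      exact (sliceMap_mem_unitBall hI).2 hz
    obtain ⟨a, -, ha⟩ := hb.sphere z.re z.im m ps h0 hsub hm
    set A := s.filter fun i => toUpperHalfPlane (b i) = z with hA
    have hmem : ∀ i ∈ A, b i ∈ sphereAt z.re z.im := fun i hi => by
      obtain ⟨I, hI, hq⟩ := exists_sliceMap_eq (b i)
      rw [← toUpperHalfPlane, (Finset.mem_filter.1 hi).2] at hq
      exact ⟨I, hI, hq⟩
    rw [Finset.card_eq_sum_card_image b A, Nat.cast_sum]
    calc ∑ q ∈ A.image b, ((A.filter fun i => b i = q).card : ℕ∞)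
        ≤ ∑ q ∈ A.image b, (Set.indicator (({a, star a} : Finset ℍ[ℝ]) : Set ℍ[ℝ])
            (fun _ => (m : ℕ∞)) q
          + Set.indicator (ps.head?.toFinset : Set ℍ[ℝ]) (fun _ => (ps.length : ℕ∞)) q) := by
          refine Finset.sum_le_sum fun q hq => ?_
          obtain ⟨i, hi, rfl⟩ := Finset.mem_image.1 hq
          have hset : (ps.head?.toFinset : Set ℍ[ℝ]) = {p | ps.head? = some p} := by
            ext p
            simp [Option.mem_toFinset]
          rw [hset, Finset.coe_pair, ← ha _ (hmem i hi), ← Set.encard_coe_eq_coe_finsetCard]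
          exact Set.encard_le_encard fun j hj => by simpa using (Finset.mem_filter.1 hj).2
      _ ≤ (({a, star a} : Finset ℍ[ℝ]).card : ℕ∞) * m + (ps.head?.toFinset.card : ℕ∞) * ps.length := by
          rw [Finset.sum_add_distrib]
          exact add_le_add (sum_indicator_le _ _ _) (sum_indicator_le _ _ _)
      -- The spherical terms sit on at most two points, `a` and its conjugate, and the isolated ones
      -- on at most one, the head of `ps`.
      _ ≤ 2 * m + 1 * ps.length := by
          gcongr
          · exact_mod_cast Finset.card_le_two
          · rw [Option.card_toFinset]
            cases ps.head? <;> simp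
      _ = stemOrder h z := by rw [ho, one_mul]

end QuaternionHardy

theorem mainTheorem5 {ι : Type*} (p : ℝ≥0∞) (hp : 0 < p) (f : ℍ[ℝ] → ℍ[ℝ])
    (hf : QuaternionHardy.MemHardy f p) (hf0 : ∃ q ∈ QuaternionHardy.unitBall, f q ≠ 0)
    (b : ι → ℍ[ℝ]) (hb : QuaternionHardy.IsZeroSequence f b) :
    Summable (fun i => 1 - ‖b i‖) := by
  classical
  obtain ⟨h, hh, hfh⟩ := hf.1.exists_stem
  obtain ⟨C, hC⟩ := hf.exists_circleAverage_log_le hp hh hfh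
  obtain ⟨K, hK⟩ := QuaternionHardy.exists_sum_order_mul_le
    (hh.differentiableOn_normSq.analyticOnNhd Metric.isOpen_ball) hC
  have hnorm : ∀ i, ‖b i‖ < 1 := fun i => by
    simpa [QuaternionHardy.unitBall] using (hb.zero i).1
  refine summable_of_sum_le (c := K) (fun i => sub_nonneg.2 (hnorm i).le) fun s => ?_
  have hball : ∀ z ∈ s.image fun i => QuaternionHardy.toUpperHalfPlane (b i),
      z ∈ Metric.ball (0 : ℂ) 1 ∧ 0 ≤ z.im := fun z hz => by
    obtain ⟨i, -, rfl⟩ := Finset.mem_image.1 hz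
    exact ⟨QuaternionHardy.toUpperHalfPlane_mem_ball (hb.zero i).1, norm_nonneg _⟩
  refine le_trans ?_ (hK (s.image fun i => QuaternionHardy.toUpperHalfPlane (b i))
    fun z hz => (hball z hz).1)
  -- Terms are grouped by sphere; all points of a sphere have the same modulus, hence the same
  -- weight `1 - |z|`.
  rw [← Finset.sum_fiberwise_of_maps_to
    (fun i hi => Finset.mem_image_of_mem (fun i => QuaternionHardy.toUpperHalfPlane (b i)) hi)]
  refine Finset.sum_le_sum fun z hz => ?_
  obtain ⟨hzb, him⟩ := hball z hz
  have ht := QuaternionHardy.stemOrder_ne_top hh hfh hf0 hzb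
  have hcard := QuaternionHardy.card_filter_le_stemOrder hh hfh hb s hzb him ht
  rw [QuaternionHardy.stemOrder, ← Nat.cast_analyticOrderNatAt ht] at hcard
  calc ∑ i ∈ s.filter fun i => QuaternionHardy.toUpperHalfPlane (b i) = z, (1 - ‖b i‖)
      = (s.filter fun i => QuaternionHardy.toUpperHalfPlane (b i) = z).card * (1 - ‖z‖) := by
        rw [← nsmul_eq_mul]
        refine Finset.sum_eq_card_nsmul fun i hi => ?_
        rw [← (Finset.mem_filter.1 hi).2, QuaternionHardy.norm_toUpperHalfPlane]
    _ ≤ _ := by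
        refine mul_le_mul_of_nonneg_right (by exact_mod_cast hcard) ?_
        have : ‖z‖ < 1 := by simpa using hzb
        linarith
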